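/- Let $d\ge 0$ be an integer, $\mathbb{T}^d=(\mathbb{R}/\mathbb{Z})^d$, and let $\mathcal{P}(\mathbb{T}^d)$ be the space of Borel probability measures on $\mathbb{T}^d$, equipped with the $\mathcal{W}_1$-Wasserstein distance (equivalently, with the topology of weak convergence). A function $\Phi:\mathcal{P}(\mathbb{T}^d)\to\mathbb{R}$ is $k$ times differentiable with respect to the measure argument if there are jointly continuous functions $\frac{\delta^\ell\Phi}{\delta m^\ell}:\mathcal{P}(\mathbb{T}^d)\times(\mathbb{T}^d)^\ell\to\mathbb{R}$, $0\le \ell\le k$, with $\frac{\delta^0\Phi}{\delta m^0}=\Phi$, such that for all $0\le \ell<k$, $m,m'\in\mathcal{P}(\mathbb{T}^d)$ and $y\in(\mathbb{T}^d)^\ell$, $$\frac{\delta^\ell\Phi}{\delta m^\ell}(m',y)-\frac{\delta^\ell\Phi}{\delta m^\ell}(m,y)=\int_0^1\int_{\mathbb{T}^d}\frac{\delta^{\ell+1}\Phi}{\delta m^{\ell+1}}\big((1-s)m+sm',y,y'\big)\,(m'-m)(\mathrm{d}y')\,\mathrm{d}s,\qquad \int_{\mathbb{T}^d}\frac{\delta^{\ell+1}\Phi}{\delta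 m^{\ell+1}}(m,y,y')\,m(\mathrm{d}y')=0 .$$ For a real $s\ge 0$ and an integer $k\ge 0$, put $n=\lfloor s\rfloor$ and $a=s-n\in[0,1)$. The function $\Phi$ satisfies $(\mathrm{Int}\text{-}\Phi\text{-}(s,k))$ if it is $k$ times differentiable with respect to $m$ and, for every $\ell\in\{0,\dots,k\}$ and all $n_1,\dots,n_\ell\in\{0,\dots,n\}$, the crossed derivatives $\partial_{y_1}^{n_1}\cdots\partial_{y_\ell}^{n_\ell}\frac{\delta^\ell\Phi}{\delta m^\ell}(m,y_1,\dots,y_\ell)$ exist, are continuous in $(y_1,\dots,y_\ell)$ and are, uniformly in $m$, bounded, continuous and, if $a>0$, $a$-Hölder continuous in $(y_1,\dots,y_\ell)$. The suprema and (if $a>0$) the Hölder constants of these derivatives, taken uniformly in $m$, are called the bounds of $\Phi$ in $(\mathrm{Int}\text{-}\Phi\text{-}(s,k))$. The function $\Phi$ is called smooth if it satisfies $(\mathrm{Int}\text{-}\Phi\text{-}(n,k))$ for all integers $n,k\ge 0$. **Theorem.** Let $\alpha\in[0,1)$ and let $\Phi:\mathcal{P}(\mathbb{T}^d)\to\mathbb{R}$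 satisfy $(\mathrm{Int}\text{-}\Phi\text{-}(\alpha,2))$. Then there exists a sequence of smooth functions $\Phi_n:\mathcal{P}(\mathbb{T}^d)\to\mathbb{R}$, each of which satisfies $(\mathrm{Int}\text{-}\Phi\text{-}(4,3))$, such that $\Phi_n$ converges to $\Phi$ uniformly on $\mathcal{P}(\mathbb{T}^d)$ and the bounds of the $\Phi_n$ in $(\mathrm{Int}\text{-}\Phi\text{-}(\alpha,2))$ are uniform in $n$: a single constant $C$ (independent of $n$) dominates all of them. -/

import Mathlib

open MeasureTheory Filter Topology

/-- The `d`-dimensional torus `(ℝ / ℤ)^d`. -/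
abbrev Torus (d : ℕ) : Type := UnitAddTorus (Fin d)

/-- The space of Borel probability measures on the torus. Mathlib equips it with the topology of
weak convergence, which (the torus being compact) is the topology of the Wasserstein distance
`W₁`. -/
abbrev ProbTorus (d : ℕ) : Type := ProbabilityMeasure (Torus d)

/-- The convex combination `(1 - s) m + s m'` of two probability measures, `s ∈ [0, 1]`. -/
noncomputable def mixture {d : ℕ} (s : unitInterval) (m m' : ProbTorus d) : ProbTorus d :=
  ⟨ENNReal.ofReal (1 - s) • (m : Measure (Torus d)) + ENNReal.ofReal s • (m' : Measure (Torus d)),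
    ⟨by
      have h0 : (0 : ℝ) ≤ s := s.2.1
      have h1 : (0 : ℝ) ≤ 1 - s := sub_nonneg.2 s.2.2
      simp only [Measure.add_apply, Measure.smul_apply, measure_univ, smul_eq_mul, mul_one]
      rw [← ENNReal.ofReal_add h1 h0]
      simp⟩⟩

/-- `V ℓ`, for `ℓ ≤ k`, is the `ℓ`-th order linear functional (flat) derivative
`δ^ℓ Φ / δ m^ℓ : P(𝕋^d) × (𝕋^d)^ℓ → ℝ` of `Φ`: the derivatives are jointly continuous, each one is
obtained from the previous one by the defining identity
`V ℓ m' y - V ℓ m y = ∫₀¹ ∫ V (ℓ+1) ((1-s) m + s m') (y, y') (m' - m)(dy') ds`,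
the new variable being the last one, and each is normalised to have zero `m`-mean in its last
variable (this makes the derivatives unique). -/
structure IsFlatDeriv {d : ℕ} (k : ℕ) (Φ : ProbTorus d → ℝ)
    (V : (ℓ : ℕ) → ProbTorus d → (Fin ℓ → Torus d) → ℝ) : Prop where
  zero : ∀ m y, V 0 m y = Φ m
  continuous : ∀ ℓ ≤ k, Continuous fun p : ProbTorus d × (Fin ℓ → Torus d) => V ℓ p.1 p.2
  sub_eq_integral : ∀ ℓ < k, ∀ (m m' : ProbTorus d) (y : Fin ℓ → Torus d),
    V ℓ m' y - V ℓ m y =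
      ∫ s : unitInterval,
        ((∫ y', V (ℓ + 1) (mixture s m m') (Fin.snoc y y') ∂(m' : Measure (Torus d))) -
          ∫ y', V (ℓ + 1) (mixture s m m') (Fin.snoc y y') ∂(m : Measure (Torus d)))
  integral_eq_zero : ∀ ℓ < k, ∀ (m : ProbTorus d) (y : Fin ℓ → Torus d),
    ∫ y', V (ℓ + 1) m (Fin.snoc y y') ∂(m : Measure (Torus d)) = 0

/-- A tuple `β = (β_1, …, β_ℓ)` of multi-indices of `ℕ^d` is admissible at level `n` if each block
satisfies `|β_i| ≤ n`; it encodes a component of `∂_{y_1}^{n_1} ⋯ ∂_{y_ℓ}^{n_ℓ}` with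
`n_i = |β_i| ∈ {0, …, n}`. -/
def Admissible {d ℓ : ℕ} (n : ℕ) (β : Fin ℓ → Fin d → ℕ) : Prop :=
  ∀ i, ∑ j, β i j ≤ n

/-- `D β`, for `β` admissible at level `n`, are the crossed partial derivatives of
`f : (𝕋^d)^ℓ → ℝ`, and they are all continuous. The derivative in the `j`-th coordinate of the
`i`-th variable is the derivative at `t = 0` along `t ↦ y + t e_{i,j}`, `t` being taken modulo 1. -/
structure IsCrossedDeriv {d ℓ : ℕ} (n : ℕ) (f : (Fin ℓ → Torus d) → ℝ)
    (D : (Fin ℓ → Fin d → ℕ) → (Fin ℓ → Torus d) → ℝ) : Prop where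
  zero : D 0 = f
  continuous : ∀ β, Admissible n β → Continuous (D β)
  hasDerivAt : ∀ (β : Fin ℓ → Fin d → ℕ) (i : Fin ℓ) (j : Fin d),
    Admissible n (β + Pi.single i (Pi.single j 1)) → ∀ y : Fin ℓ → Torus d,
      HasDerivAt (fun t : ℝ => D β (y + Pi.single i (Pi.single j (t : UnitAddCircle))))
        (D (β + Pi.single i (Pi.single j 1)) y) 0

/-- `Φ` satisfies Int-`Φ`-`(s, k)` with all the bounds in it being at most `C`. Here `n = ⌊s⌋` and
`a = s - n`. The function `Φ` is `k` times differentiable in the measure argument, and for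
`ℓ ≤ k` the crossed derivatives of `δ^ℓ Φ / δ m^ℓ` in the variables `y_1, …, y_ℓ`, up to order `n`
in each of them, exist, are continuous and, uniformly in `m`, are bounded by `C`,
(equi)continuous and, if `a > 0`, `a`-Hölder with constant `C`. The distance on `(𝕋^d)^ℓ` is the
maximum of the coordinate distances, which is equivalent to the Euclidean one. -/
def IntPhiBound {d : ℕ} (s : ℝ) (k : ℕ) (C : ℝ) (Φ : ProbTorus d → ℝ) : Prop :=
  ∃ V : (ℓ : ℕ) → ProbTorus d → (Fin ℓ → Torus d) → ℝ, IsFlatDeriv k Φ V ∧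
    ∀ ℓ ≤ k, ∃ D : (Fin ℓ → Fin d → ℕ) → ProbTorus d → (Fin ℓ → Torus d) → ℝ,
      (∀ m, IsCrossedDeriv ⌊s⌋₊ (V ℓ m) fun β => D β m) ∧
      ∀ β, Admissible ⌊s⌋₊ β →
        (∀ m y, |D β m y| ≤ C) ∧
        UniformEquicontinuous (D β) ∧
        (0 < s - ⌊s⌋₊ → ∀ m y z, |D β m y - D β m z| ≤ C * dist y z ^ (s - ⌊s⌋₊))

/-- The condition Int-`Φ`-`(s, k)`. -/
def IntPhi {d : ℕ} (s : ℝ) (k : ℕ) (Φ : ProbTorus d → ℝ) : Prop :=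
  ∃ C : ℝ, IntPhiBound s k C Φ

/-- A smooth functional on `P(𝕋^d)`: it has flat derivatives of every order in `m`, and each of them
has bounded continuous crossed derivatives of every order in the space variables. -/
def SmoothFunctional {d : ℕ} (Φ : ProbTorus d → ℝ) : Prop :=
  ∀ n k : ℕ, IntPhi (n : ℝ) k Φ

/-!
Replace `Φ(m)` by the mean of `Φ` at the empirical measure of `N` independent points, each the sum
of a point of law `m` and a perturbation of density `ρ`, where `ρ` is a nonnegative trigonometric
polynomial. Since `ρ(z - x)` is a finite sum of products of functions of `z` and of `x`, the result
is `∫ F dm^{⊗ N}` for a finite sum `F` of tensor products of trigonometric polynomials, hence a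
polynomial in finitely many integrals of smooth functions. It converges to `Φ`, uniformly in `m`, by
the weak law of large numbers and because the densities `ρ` approximate the Dirac mass at `0`.

The first two flat derivatives of `∫ F dm^{⊗ N}` are integrals of sums of `N` first differences and
of `N ^ 2` mixed second differences of `F`. Moving one point changes the empirical measure by
`1 / N`, so the derivatives of `Φ` bound these differences by multiples of `1 / N` and `1 / N ^ 2`,
except for the `N` diagonal second differences, which are of order `1 / N`. Hence bounds which do
not depend on `N`.
-/

section Compactness

variable {X Y : Type*} [TopologicalSpace X] [CompactSpace X]

lemma exists_abs_le_of_continuous {f : X → ℝ} (hf : Continuous f) : ∃ C, ∀ x, |f x| ≤ C := by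
  obtain ⟨C, hC⟩ := (isCompact_range hf).isBounded.exists_norm_le
  exact ⟨C, fun x => hC _ ⟨x, rfl⟩⟩

lemma uniformEquicontinuous_of_continuous [UniformSpace Y] [CompactSpace Y] {f : X → Y → ℝ}
    (hf : Continuous fun p : X × Y => f p.1 p.2) : UniformEquicontinuous f := by
  let g : C(Y, C(X, ℝ)) := ContinuousMap.curry ⟨fun p : Y × X => f p.2 p.1, by fun_prop⟩
  have hg := CompactSpace.uniformContinuous_of_continuous g.continuous
  rw [Metric.uniformEquicontinuous_iff_right]
  intro ε hε
  filter_upwards [hg (Metric.dist_mem_uniformity hε)] with p hp x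
  exact (ContinuousMap.dist_apply_le_dist x).trans_lt hp

lemma exists_translation_modulus {G : Type*} [TopologicalSpace G] [CompactSpace G] [AddMonoid G]
    [ContinuousAdd G] {f : X → G → ℝ} (hf : Continuous fun p : X × G => f p.1 p.2) :
    ∃ ω : C(G, ℝ), ω 0 = 0 ∧ ∀ n x t, |f n (x + t) - f n x| ≤ ω t := by
  let g : C(G, C(X × G, ℝ)) := ContinuousMap.curry
    ⟨fun p : G × X × G => f p.2.1 (p.2.2 + p.1) - f p.2.1 p.2.2, by fun_prop⟩
  refine ⟨⟨fun t => ‖g t‖, by fun_prop⟩, ?_, fun n x t => (g t).norm_coe_le_norm (n, x)⟩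
  have hg : g 0 = 0 := by ext p; simp [g]
  simp [hg]

variable [MeasurableSpace X] [OpensMeasurableSpace X] {μ : Measure X} [IsFiniteMeasure μ]

lemma integrable_of_continuous {f : X → ℝ} (hf : Continuous f) : Integrable f μ :=
  hf.integrable_of_hasCompactSupport (HasCompactSupport.of_compactSpace f)

lemma continuous_integral_of_continuous [TopologicalSpace Y] [FirstCountableTopology Y]
    [LocallyCompactSpace Y] {f : Y → X → ℝ} (hf : Continuous fun p : Y × X => f p.1 p.2) :
    Continuous fun y => ∫ x, f y x ∂μ := by
  simpa using continuous_parametric_integral_of_continuous (μ := μ) (f := f) hf isCompact_univ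

end Compactness

section ProbabilityIntegral

variable {X : Type*} [MeasurableSpace X] {μ : Measure X} [IsProbabilityMeasure μ]

lemma abs_integral_le_of_abs_le {f : X → ℝ} {C : ℝ} (h : ∀ x, |f x| ≤ C) :
    |∫ x, f x ∂μ| ≤ C := by
  simpa using norm_integral_le_of_norm_le_const (μ := μ) (Eventually.of_forall
    fun x => (Real.norm_eq_abs _).trans_le (h x))

lemma abs_integral_sub_integral_le {f g : X → ℝ} (hf : Integrable f μ) (hg : Integrable g μ)
    {C : ℝ} (h : ∀ x, |f x - g x| ≤ C) : |∫ x, f x ∂μ - ∫ x, g x ∂μ| ≤ C := by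
  rw [← integral_sub hf hg]
  exact abs_integral_le_of_abs_le h

lemma abs_integral_sub_const_le {f g : X → ℝ} (hf : Integrable f μ) (hg : Integrable g μ) {c : ℝ}
    (h : ∀ x, |f x - c| ≤ g x) : |∫ x, f x ∂μ - c| ≤ ∫ x, g x ∂μ := by
  have hc : Integrable (fun x => f x - c) μ := hf.sub (integrable_const c)
  calc |∫ x, f x ∂μ - c| = |∫ x, (f x - c) ∂μ| := by
        rw [integral_sub hf (integrable_const c), integral_const, probReal_univ, one_smul]
    _ ≤ ∫ x, |f x - c| ∂μ := abs_integral_le_integral_abs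
    _ ≤ ∫ x, g x ∂μ := integral_mono hc.abs hg h

lemma integral_abs_sub_integral_le_sqrt_variance {f : X → ℝ} (hf : MemLp f 2 μ) :
    ∫ x, |f x - ∫ y, f y ∂μ| ∂μ ≤ √(ProbabilityTheory.variance f μ) := by
  have hcentered : MemLp (fun x => |f x - ∫ y, f y ∂μ|) 2 μ :=
    (hf.sub (memLp_const _)).abs
  refine Real.le_sqrt_of_sq_le ?_
  rw [ProbabilityTheory.variance_eq_integral hf.aemeasurable]
  have h := ProbabilityTheory.variance_eq_sub hcentered ▸ ProbabilityTheory.variance_nonneg _ μ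
  simpa only [Pi.pow_apply, sq_abs, sub_nonneg] using h

end ProbabilityIntegral

section Update

variable {ι X : Type*} [DecidableEq ι]

lemma update_add_apply [Add X] (x z : ι → X) (i : ι) (a : X) :
    Function.update x i a + z = Function.update (x + z) i (a + z i) := by
  simp [Function.update_add]

lemma add_single_eq_update [AddZeroClass X] (x : ι → X) (i : ι) (a : X) :
    x + Pi.single i a = Function.update x i (x i + a) := by
  rw [Pi.single]; simpa using (Function.update_add x 0 i (x i) a).symm

lemma prod_apply_update [Fintype ι] {M : Type*} [CommMonoid M] (f : ι → X → M) (x : ι → X) (i : ι)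
    (a : X) :
    ∏ j, f j (Function.update x i a j) = f i a * ∏ j ∈ Finset.univ.erase i, f j (x j) := by
  simp only [Function.apply_update f, Finset.prod_update_of_mem (Finset.mem_univ i),
    Finset.sdiff_singleton_eq_erase]

end Update

section Mixture

variable {d : ℕ}

lemma integral_mixture (s : unitInterval) (m m' : ProbTorus d) {f : Torus d → ℝ}
    (hf : Continuous f) :
    ∫ x, f x ∂(mixture s m m' : Measure (Torus d)) =
      (1 - s) * ∫ x, f x ∂(m : Measure (Torus d)) + s * ∫ x, f x ∂(m' : Measure (Torus d)) := by
  have hs : (0 : ℝ) ≤ 1 - s := sub_nonneg.2 s.2.2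
  change ∫ x, f x ∂(ENNReal.ofReal (1 - s) • (m : Measure (Torus d)) +
    ENNReal.ofReal s • (m' : Measure (Torus d))) = _
  rw [integral_add_measure ((integrable_of_continuous hf).smul_measure ENNReal.ofReal_ne_top)
    ((integrable_of_continuous hf).smul_measure ENNReal.ofReal_ne_top), integral_smul_measure,
    integral_smul_measure, ENNReal.toReal_ofReal s.2.1, ENNReal.toReal_ofReal hs, smul_eq_mul,
    smul_eq_mul]

lemma continuous_integral_probTorus {f : Torus d → ℝ} (hf : Continuous f) :
    Continuous fun m : ProbTorus d => ∫ x, f x ∂(m : Measure (Torus d)) :=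
  ProbabilityMeasure.continuous_integral_continuousMap (⟨f, hf⟩ : C(Torus d, ℝ))

lemma continuous_mixture (m m' : ProbTorus d) : Continuous fun s => mixture s m m' := by
  rw [ProbabilityMeasure.continuous_iff_forall_continuousMap_continuous_integral]
  intro f
  simp_rw [integral_mixture _ m m' f.continuous]
  fun_prop

lemma probTorus_ext {m m' : ProbTorus d}
    (h : ∀ f : Torus d → ℝ, Continuous f →
      ∫ x, f x ∂(m : Measure (Torus d)) = ∫ x, f x ∂(m' : Measure (Torus d))) : m = m' :=
  ProbabilityMeasure.toMeasure_injective
    (ext_of_forall_integral_eq_of_IsFiniteMeasure fun f => h f f.continuous)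

lemma integral_diracProba (a : Torus d) (f : Torus d → ℝ) :
    ∫ y, f y ∂(diracProba a : Measure (Torus d)) = f a :=
  integral_dirac f a

end Mixture

section LinearDerivative

variable {d : ℕ}

/-- `U'` is a jointly continuous linear functional derivative of `U`. In contrast with
`IsFlatDeriv` it is not normalised, since only its oscillation in the second variable matters for
the increments of `U`. -/
structure IsLinearDeriv (U : ProbTorus d → ℝ) (U' : ProbTorus d → Torus d → ℝ) : Prop where
  continuous_deriv : Continuous fun p : ProbTorus d × Torus d => U' p.1 p.2
  sub_eq : ∀ m m' : ProbTorus d, U m' - U m =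
    ∫ s : unitInterval, ((∫ y, U' (mixture s m m') y ∂(m' : Measure (Torus d))) -
      ∫ y, U' (mixture s m m') y ∂(m : Measure (Torus d)))

namespace IsLinearDeriv

variable {U W : ProbTorus d → ℝ} {U' W' : ProbTorus d → Torus d → ℝ}

lemma continuous_deriv_apply (h : IsLinearDeriv U U') (m : ProbTorus d) : Continuous (U' m) :=
  h.continuous_deriv.comp (Continuous.prodMk_right m)

lemma integrable_integral_mixture_sub (h : IsLinearDeriv U U') (m m' n n' : ProbTorus d) :
    Integrable fun s : unitInterval =>
      (∫ y, U' (mixture s m m') y ∂(n' : Measure (Torus d))) -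
        ∫ y, U' (mixture s m m') y ∂(n : Measure (Torus d)) := by
  have hU' : Continuous fun p : unitInterval × Torus d => U' (mixture p.1 m m') p.2 :=
    h.continuous_deriv.comp
      (((continuous_mixture m m').comp continuous_fst).prodMk continuous_snd)
  exact integrable_of_continuous
    ((continuous_integral_of_continuous hU').sub (continuous_integral_of_continuous hU'))

lemma zero : IsLinearDeriv (fun _ : ProbTorus d => 0) fun _ _ => 0 :=
  ⟨continuous_const, fun _ _ => by simp⟩

lemma add (hU : IsLinearDeriv U U') (hW : IsLinearDeriv W W') :
    IsLinearDeriv (fun m => U m + W m) (fun m y => U' m y + W' m y) := by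
  refine ⟨hU.continuous_deriv.add hW.continuous_deriv, fun m m' => ?_⟩
  have integral_add' (p n : ProbTorus d) : ∫ y, (U' p y + W' p y) ∂(n : Measure (Torus d)) =
      ∫ y, U' p y ∂(n : Measure (Torus d)) + ∫ y, W' p y ∂(n : Measure (Torus d)) :=
    integral_add (integrable_of_continuous (hU.continuous_deriv_apply _))
      (integrable_of_continuous (hW.continuous_deriv_apply _))
  simp_rw [integral_add', add_sub_add_comm]
  rw [hU.sub_eq, hW.sub_eq, integral_add (hU.integrable_integral_mixture_sub _ _ _ _)
    (hW.integrable_integral_mixture_sub _ _ _ _)]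

lemma const_mul (hU : IsLinearDeriv U U') (c : ℝ) :
    IsLinearDeriv (fun m => c * U m) (fun m y => c * U' m y) :=
  ⟨continuous_const.mul hU.continuous_deriv, fun m m' => by
    simp_rw [integral_const_mul, ← mul_sub, hU.sub_eq, integral_const_mul]⟩

lemma sub (hU : IsLinearDeriv U U') (hW : IsLinearDeriv W W') :
    IsLinearDeriv (fun m => U m - W m) (fun m y => U' m y - W' m y) := by
  simpa only [neg_one_mul, ← sub_eq_add_neg] using hU.add (hW.const_mul (-1))

lemma abs_sub_le (h : IsLinearDeriv U U') {m m' : ProbTorus d} {B : ℝ}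
    (hB : ∀ n, |∫ y, U' n y ∂(m' : Measure (Torus d)) - ∫ y, U' n y ∂(m : Measure (Torus d))| ≤ B) :
    |U m' - U m| ≤ B := by
  rw [h.sub_eq]
  exact abs_integral_le_of_abs_le fun s => hB _

-- By compactness of `P(𝕋^d)` the functions `U' n` form a totally bounded family: `S` is an
-- `ε/2`-net of it for the uniform norm.
lemma exists_finset_abs_sub_le (h : IsLinearDeriv U U') {ε : ℝ} (hε : 0 < ε) :
    ∃ S : Finset C(Torus d, ℝ), ∀ m m' : ProbTorus d, |U m' - U m| ≤
      ε + ∑ f ∈ S, |∫ x, f x ∂(m' : Measure (Torus d)) - ∫ x, f x ∂(m : Measure (Torus d))| := by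
  let g : C(ProbTorus d, C(Torus d, ℝ)) := ContinuousMap.curry ⟨_, h.continuous_deriv⟩
  obtain ⟨t, -, ht, hcover⟩ :=
    (isCompact_range g.continuous).finite_cover_balls (half_pos hε)
  refine ⟨ht.toFinset, fun m m' => h.abs_sub_le fun n => ?_⟩
  obtain ⟨f, hft, hf⟩ := Set.mem_iUnion₂.1 (hcover ⟨n, rfl⟩)
  have hclose (p : ProbTorus d) :
      |∫ y, U' n y ∂(p : Measure (Torus d)) - ∫ y, f y ∂(p : Measure (Torus d))| ≤ ε / 2 :=
    abs_integral_sub_integral_le (integrable_of_continuous (h.continuous_deriv_apply n))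
      (integrable_of_continuous f.continuous)
      fun y => (ContinuousMap.dist_apply_le_dist y).trans (Metric.mem_ball.1 hf).le
  have hterm := Finset.single_le_sum (f := fun f : C(Torus d, ℝ) =>
    |∫ x, f x ∂(m' : Measure (Torus d)) - ∫ x, f x ∂(m : Measure (Torus d))|)
    (fun _ _ => abs_nonneg _) (ht.mem_toFinset.2 hft)
  have hm := abs_le.1 (hclose m)
  have hm' := abs_le.1 (hclose m')
  have hf' := abs_le.1 hterm
  rw [abs_le]
  constructor <;> linarith [hm.1, hm.2, hm'.1, hm'.2, hf'.1, hf'.2]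

lemma continuous (h : IsLinearDeriv U U') : Continuous U := by
  rw [Metric.continuous_iff']
  intro m ε hε
  obtain ⟨S, hS⟩ := h.exists_finset_abs_sub_le (half_pos hε)
  have hsum : Continuous fun m' : ProbTorus d => ε / 2 + ∑ f ∈ S,
      |∫ x, f x ∂(m' : Measure (Torus d)) - ∫ x, f x ∂(m : Measure (Torus d))| :=
    continuous_const.add (continuous_finsetSum _ fun f _ =>
      ((continuous_integral_probTorus f.continuous).sub continuous_const).abs)
  have hm : ε / 2 + ∑ f ∈ S,
      |∫ x, f x ∂(m : Measure (Torus d)) - ∫ x, f x ∂(m : Measure (Torus d))| < ε := by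
    simpa using half_lt_self hε
  filter_upwards [(hsum.tendsto m).eventually_lt_const hm] with m' hm'
  exact (hS m m').trans_lt hm'

end IsLinearDeriv

end LinearDerivative

section AverageMeasure

variable {d N : ℕ} [NeZero N]

/-- The arithmetic mean of finitely many probability measures. -/
noncomputable def averageMeasure (ξ : Fin N → ProbTorus d) : ProbTorus d :=
  ⟨(N : ENNReal)⁻¹ • ∑ i, (ξ i : Measure (Torus d)),
    ⟨by simp [ENNReal.inv_mul_cancel (Nat.cast_ne_zero.2 (NeZero.ne N))]⟩⟩

/-- The empirical measure `N⁻¹ ∑ i, δ_{z_i}` of a sample of `N` points. -/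
noncomputable def empiricalMeasure (z : Fin N → Torus d) : ProbTorus d :=
  averageMeasure fun i => diracProba (z i)

lemma integral_averageMeasure (ξ : Fin N → ProbTorus d) {f : Torus d → ℝ} (hf : Continuous f) :
    ∫ x, f x ∂(averageMeasure ξ : Measure (Torus d)) =
      (∑ i, ∫ x, f x ∂(ξ i : Measure (Torus d))) / N := by
  change ∫ x, f x ∂((N : ENNReal)⁻¹ • ∑ i, (ξ i : Measure (Torus d))) = _
  rw [integral_smul_measure, integral_finsetSum_measure fun i _ => integrable_of_continuous hf]
  simp [div_eq_inv_mul]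

lemma integral_empiricalMeasure (z : Fin N → Torus d) {f : Torus d → ℝ} (hf : Continuous f) :
    ∫ x, f x ∂(empiricalMeasure z : Measure (Torus d)) = (∑ i, f (z i)) / N := by
  simp only [empiricalMeasure, integral_averageMeasure _ hf, integral_diracProba]

lemma continuous_empiricalMeasure : Continuous (empiricalMeasure (d := d) (N := N)) := by
  rw [ProbabilityMeasure.continuous_iff_forall_continuousMap_continuous_integral]
  intro f
  simp_rw [integral_empiricalMeasure _ f.continuous]
  fun_prop

lemma empiricalMeasure_update (z : Fin N → Torus d) (i : Fin N) (a : Torus d) :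
    empiricalMeasure (Function.update z i a) =
      averageMeasure (Function.update (fun j => diracProba (z j)) i (diracProba a)) :=
  congrArg averageMeasure (funext fun j => Function.apply_update (fun _ => diracProba) z i a j)

lemma integral_averageMeasure_update (ξ : Fin N → ProbTorus d) (i : Fin N) (p : ProbTorus d)
    {f : Torus d → ℝ} (hf : Continuous f) :
    ∫ x, f x ∂(averageMeasure (Function.update ξ i p) : Measure (Torus d)) =
      (∫ x, f x ∂(p : Measure (Torus d)) +
        ∑ j ∈ Finset.univ.erase i, ∫ x, f x ∂(ξ j : Measure (Torus d))) / N := by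
  rw [integral_averageMeasure _ hf, ← Finset.add_sum_erase _ _ (Finset.mem_univ i),
    Function.update_self]
  congr 2
  exact Finset.sum_congr rfl fun j hj => by
    rw [Function.update_of_ne (Finset.ne_of_mem_erase hj)]

lemma mixture_averageMeasure_update (ξ : Fin N → ProbTorus d) (i : Fin N) (s : unitInterval)
    (p q : ProbTorus d) :
    mixture s (averageMeasure (Function.update ξ i q)) (averageMeasure (Function.update ξ i p)) =
      averageMeasure (Function.update ξ i (mixture s q p)) :=
  probTorus_ext fun f hf => by
    simp_rw [integral_mixture _ _ _ hf, integral_averageMeasure_update _ _ _ hf,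
      integral_mixture _ _ _ hf]
    ring

namespace IsLinearDeriv

variable {U : ProbTorus d → ℝ} {U₁ : ProbTorus d → Torus d → ℝ}
  {U₂ : ProbTorus d → Torus d → Torus d → ℝ}

lemma averageMeasure_update_sub (h : IsLinearDeriv U U₁) (ξ : Fin N → ProbTorus d) (i : Fin N)
    (p q : ProbTorus d) :
    U (averageMeasure (Function.update ξ i p)) - U (averageMeasure (Function.update ξ i q)) =
      (∫ s : unitInterval,
        ((∫ y, U₁ (averageMeasure (Function.update ξ i (mixture s q p))) y
            ∂(p : Measure (Torus d))) -
          ∫ y, U₁ (averageMeasure (Function.update ξ i (mixture s q p))) y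
            ∂(q : Measure (Torus d)))) / N := by
  simp_rw [h.sub_eq, mixture_averageMeasure_update,
    integral_averageMeasure_update _ _ _ (h.continuous_deriv_apply _), ← sub_div,
    add_sub_add_right_eq_sub, integral_div]

lemma abs_averageMeasure_update_sub_le (h : IsLinearDeriv U U₁) (ξ : Fin N → ProbTorus d)
    (i : Fin N) {p q : ProbTorus d} {B : ℝ}
    (hB : ∀ n, |∫ y, U₁ n y ∂(p : Measure (Torus d)) - ∫ y, U₁ n y ∂(q : Measure (Torus d))| ≤ B) :
    |U (averageMeasure (Function.update ξ i p)) - U (averageMeasure (Function.update ξ i q))| ≤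
      B / N := by
  rw [h.averageMeasure_update_sub, abs_div, Nat.abs_cast]
  gcongr
  exact abs_integral_le_of_abs_le fun s => hB _

lemma abs_averageMeasure_update_diracProba_sub_le (h : IsLinearDeriv U U₁)
    (ξ : Fin N → ProbTorus d) (i : Fin N) {a a' : Torus d} {B : ℝ}
    (hB : ∀ n, |U₁ n a - U₁ n a'| ≤ B) :
    |U (averageMeasure (Function.update ξ i (diracProba a))) -
      U (averageMeasure (Function.update ξ i (diracProba a')))| ≤ B / N :=
  h.abs_averageMeasure_update_sub_le ξ i fun n => by
    simpa only [integral_diracProba] using hB n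

lemma abs_second_difference_averageMeasure_le (h₁ : IsLinearDeriv U U₁)
    (h₂ : ∀ a, IsLinearDeriv (fun m => U₁ m a) fun m => U₂ m a) (ξ : Fin N → ProbTorus d)
    {i j : Fin N} (hij : i ≠ j) {a a' b b' : Torus d} {B : ℝ}
    (hB : ∀ n, |(U₂ n a b - U₂ n a' b) - (U₂ n a b' - U₂ n a' b')| ≤ B) :
    |(U (averageMeasure
          (Function.update (Function.update ξ j (diracProba b)) i (diracProba a))) -
        U (averageMeasure
          (Function.update (Function.update ξ j (diracProba b)) i (diracProba a')))) -
      (U (averageMeasure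
          (Function.update (Function.update ξ j (diracProba b')) i (diracProba a))) -
        U (averageMeasure
          (Function.update (Function.update ξ j (diracProba b')) i (diracProba a'))))| ≤
      B / N / N := by
  have hint (c : Torus d) := h₁.integrable_integral_mixture_sub
    (averageMeasure (Function.update (Function.update ξ j (diracProba c)) i (diracProba a')))
    (averageMeasure (Function.update (Function.update ξ j (diracProba c)) i (diracProba a)))
    (diracProba a') (diracProba a)
  simp only [mixture_averageMeasure_update, integral_diracProba] at hint
  simp only [h₁.averageMeasure_update_sub, integral_diracProba]
  rw [← sub_div, abs_div, Nat.abs_cast]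
  gcongr
  refine abs_integral_sub_integral_le (hint b) (hint b') fun s => ?_
  rw [Function.update_comm hij.symm, Function.update_comm hij.symm]
  exact ((h₂ a).sub (h₂ a')).abs_averageMeasure_update_diracProba_sub_le _ j hB

end IsLinearDeriv

end AverageMeasure

section LawOfLargeNumbers

variable {d N : ℕ} [NeZero N]

lemma integral_integral_empiricalMeasure (m : ProbTorus d) {f : Torus d → ℝ} (hf : Continuous f) :
    ∫ x, (∫ y, f y ∂(empiricalMeasure x : Measure (Torus d)))
        ∂(Measure.pi fun _ : Fin N => (m : Measure (Torus d))) =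
      ∫ y, f y ∂(m : Measure (Torus d)) := by
  simp_rw [integral_empiricalMeasure _ hf]
  rw [integral_div, integral_finsetSum _ fun i _ => integrable_of_continuous (by fun_prop)]
  simp only [integral_comp_eval (μ := fun _ : Fin N => (m : Measure (Torus d)))
    hf.aestronglyMeasurable, Finset.sum_const, Finset.card_univ, Fintype.card_fin, nsmul_eq_mul]
  exact mul_div_cancel_left₀ _ (Nat.cast_ne_zero.2 (NeZero.ne N))

lemma variance_integral_empiricalMeasure (m : ProbTorus d) {f : Torus d → ℝ} (hf : Continuous f) :
    ProbabilityTheory.variance (fun x => ∫ y, f y ∂(empiricalMeasure x : Measure (Torus d)))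
        (Measure.pi fun _ : Fin N => (m : Measure (Torus d))) =
      ProbabilityTheory.variance f (m : Measure (Torus d)) / N := by
  have hsum := ProbabilityTheory.variance_sum_pi (ι := Fin N) (X := fun _ => f)
    (μ := fun _ => (m : Measure (Torus d))) fun _ =>
      hf.memLp_of_hasCompactSupport (HasCompactSupport.of_compactSpace f)
  have hmean : (fun x : Fin N → Torus d => ∫ y, f y ∂(empiricalMeasure x : Measure (Torus d))) =
      fun x => (N : ℝ)⁻¹ * (∑ i, fun ω : Fin N → Torus d => f (ω i)) x := by
    funext x
    rw [integral_empiricalMeasure _ hf, Finset.sum_apply, div_eq_inv_mul]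
  rw [hmean, ProbabilityTheory.variance_const_mul, hsum, Finset.sum_const, Finset.card_univ,
    Fintype.card_fin, nsmul_eq_mul]
  have hN : (N : ℝ) ≠ 0 := Nat.cast_ne_zero.2 (NeZero.ne N)
  field_simp

lemma integral_abs_integral_empiricalMeasure_sub_le (m : ProbTorus d) (f : C(Torus d, ℝ)) :
    ∫ x, |∫ y, f y ∂(empiricalMeasure x : Measure (Torus d)) - ∫ y, f y ∂(m : Measure (Torus d))|
        ∂(Measure.pi fun _ : Fin N => (m : Measure (Torus d))) ≤ ‖f‖ / √N := by
  have hcont : Continuous fun x : Fin N → Torus d =>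
      ∫ y, f y ∂(empiricalMeasure x : Measure (Torus d)) :=
    (continuous_integral_probTorus f.continuous).comp continuous_empiricalMeasure
  have hvar : ProbabilityTheory.variance f (m : Measure (Torus d)) ≤ ‖f‖ ^ 2 := by
    have h := ProbabilityTheory.variance_le_sq_of_bounded (μ := (m : Measure (Torus d)))
      (Eventually.of_forall fun x => abs_le.1 (f.norm_coe_le_norm x)) f.continuous.aemeasurable
    rwa [sub_neg_eq_add, add_self_div_two] at h
  have h := integral_abs_sub_integral_le_sqrt_variance
    (μ := Measure.pi fun _ : Fin N => (m : Measure (Torus d)))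
    (hcont.memLp_of_hasCompactSupport (HasCompactSupport.of_compactSpace _))
  rw [integral_integral_empiricalMeasure m f.continuous,
    variance_integral_empiricalMeasure m f.continuous] at h
  calc _ ≤ √(ProbabilityTheory.variance f (m : Measure (Torus d)) / N) := h
    _ ≤ √(‖f‖ ^ 2 / N) := by gcongr
    _ = ‖f‖ / √N := by rw [Real.sqrt_div' _ N.cast_nonneg, Real.sqrt_sq (norm_nonneg f)]

lemma IsLinearDeriv.exists_abs_integral_empiricalMeasure_sub_le {U : ProbTorus d → ℝ}
    {U' : ProbTorus d → Torus d → ℝ} (h : IsLinearDeriv U U') {ε : ℝ} (hε : 0 < ε) :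
    ∃ B : ℝ, ∀ (N : ℕ) [NeZero N] (m : ProbTorus d),
      |∫ x, U (empiricalMeasure x) ∂(Measure.pi fun _ : Fin N => (m : Measure (Torus d))) - U m| ≤
        ε + B / √N := by
  obtain ⟨S, hS⟩ := h.exists_finset_abs_sub_le hε
  refine ⟨∑ f ∈ S, ‖f‖, fun N _ m => ?_⟩
  have hcont (f : C(Torus d, ℝ)) : Continuous fun x : Fin N → Torus d =>
      |∫ y, f y ∂(empiricalMeasure x : Measure (Torus d)) - ∫ y, f y ∂(m : Measure (Torus d))| :=
    (((continuous_integral_probTorus f.continuous).comp continuous_empiricalMeasure).sub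
      continuous_const).abs
  have hint := fun f : C(Torus d, ℝ) => integrable_of_continuous
    (μ := Measure.pi fun _ : Fin N => (m : Measure (Torus d))) (hcont f)
  refine (abs_integral_sub_const_le
    (integrable_of_continuous (h.continuous.comp continuous_empiricalMeasure))
    ((integrable_const ε).add (integrable_finsetSum S fun f _ => hint f))
    fun x => hS m (empiricalMeasure x)).trans ?_
  rw [integral_add' (integrable_const ε) (integrable_finsetSum S fun f _ => hint f),
    integral_const, probReal_univ, one_smul, integral_finsetSum S fun f _ => hint f,
    Finset.sum_div]
  gcongr with f
  exact integral_abs_integral_empiricalMeasure_sub_le m f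

lemma IsLinearDeriv.tendstoUniformly_integral_empiricalMeasure {U : ProbTorus d → ℝ}
    {U' : ProbTorus d → Torus d → ℝ} (h : IsLinearDeriv U U') :
    TendstoUniformly (fun (n : ℕ) (m : ProbTorus d) => ∫ x, U (empiricalMeasure x)
      ∂(Measure.pi fun _ : Fin (n + 1) => (m : Measure (Torus d)))) U atTop := by
  rw [Metric.tendstoUniformly_iff]
  intro ε hε
  obtain ⟨B, hB⟩ := h.exists_abs_integral_empiricalMeasure_sub_le (half_pos hε)
  have hlim : Tendsto (fun n : ℕ => ε / 2 + B / √((n + 1 : ℕ) : ℝ)) atTop (𝓝 (ε / 2 + 0)) :=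
    tendsto_const_nhds.add (tendsto_const_nhds.div_atTop (Real.tendsto_sqrt_atTop.comp
      (tendsto_natCast_atTop_atTop.comp (tendsto_add_atTop_nat 1))))
  rw [add_zero] at hlim
  filter_upwards [hlim.eventually_lt_const (half_lt_self hε)] with n hn m
  rw [dist_comm]
  exact (hB (n + 1) m).trans_lt hn

end LawOfLargeNumbers

section SmoothOnTorus

variable {d : ℕ}

/-- A function on the torus with continuous partial derivatives `D β` of every order `β`. -/
def IsSmoothOnTorus (f : C(Torus d, ℝ)) : Prop :=
  ∃ D : (Fin d → ℕ) → C(Torus d, ℝ), D 0 = f ∧ ∀ β j x,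
    HasDerivAt (fun t : ℝ => D β (x + Pi.single j (t : UnitAddCircle)))
      (D (β + Pi.single j 1) x) 0

lemma mFourier_add_single (k : Fin d → ℤ) (x : Torus d) (j : Fin d) (t : UnitAddCircle) :
    UnitAddTorus.mFourier k (x + Pi.single j t) = UnitAddTorus.mFourier k x * fourier (k j) t := by
  change ∏ i, fourier (k i) ((x + Pi.single j t : Torus d) i) =
    (∏ i, fourier (k i) (x i)) * fourier (k j) t
  rw [add_single_eq_update, prod_apply_update (fun i => fourier (k i)), fourier_apply, smul_add,
    AddCircle.toCircle_add, ← Finset.mul_prod_erase _ _ (Finset.mem_univ j)]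
  simp only [Circle.coe_mul, fourier_apply]
  ring

lemma isSmoothOnTorus_re_mul_mFourier (c : ℂ) (k : Fin d → ℤ) :
    IsSmoothOnTorus ⟨fun x => (c * UnitAddTorus.mFourier k x).re, by fun_prop⟩ := by
  refine ⟨fun β => ⟨fun x => (c * (∏ j, (2 * Real.pi * Complex.I * k j) ^ β j) *
    UnitAddTorus.mFourier k x).re, by fun_prop⟩, by simp, fun β j x => ?_⟩
  have hfourier := (hasDerivAt_fourier 1 (k j) 0).const_mul
    (c * (∏ i, (2 * Real.pi * Complex.I * k i) ^ β i) * UnitAddTorus.mFourier k x)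
  have hre := Complex.reCLM.hasFDerivAt.comp_hasDerivAt 0 hfourier
  have hprod : ∏ i, (2 * Real.pi * Complex.I * k i : ℂ) ^ (β + Pi.single j 1 : Fin d → ℕ) i =
      (∏ i, (2 * Real.pi * Complex.I * k i) ^ β i) * (2 * Real.pi * Complex.I * k j) := by
    rw [add_single_eq_update,
      prod_apply_update (fun i n => (2 * Real.pi * Complex.I * k i : ℂ) ^ n),
      ← Finset.mul_prod_erase _ _ (Finset.mem_univ j)]
    ring
  refine (hre.congr_deriv ?_).congr_of_eventuallyEq (Eventually.of_forall fun t => ?_)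
  · simp only [ContinuousMap.coe_mk, hprod, Complex.reCLM_apply]
    congr 1
    simp only [Complex.ofReal_one, div_one, QuotientAddGroup.mk_zero, fourier_apply, smul_zero,
      AddCircle.toCircle_zero, Circle.coe_one, mul_one]
    ring
  · simp only [ContinuousMap.coe_mk, mFourier_add_single, Function.comp_apply,
      Complex.reCLM_apply, mul_assoc]

lemma isSmoothOnTorus_one : IsSmoothOnTorus (1 : C(Torus d, ℝ)) := by
  convert isSmoothOnTorus_re_mul_mFourier 1 (0 : Fin d → ℤ)
  ext x
  simp [UnitAddTorus.mFourier_zero]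

end SmoothOnTorus

section CrossedDerivatives

variable {d ℓ : ℕ}

/-- `W` has crossed derivatives `D β` of every order `β` in the space variables, and they are
jointly continuous in the measure and in the space variables. -/
def HasCrossedDerivs (W : ProbTorus d → (Fin ℓ → Torus d) → ℝ) : Prop :=
  ∃ D : (Fin ℓ → Fin d → ℕ) → ProbTorus d → (Fin ℓ → Torus d) → ℝ, D 0 = W ∧
    (∀ β, Continuous fun p : ProbTorus d × (Fin ℓ → Torus d) => D β p.1 p.2) ∧
    ∀ β i j m y, HasDerivAt
      (fun t : ℝ => D β m (y + Pi.single i (Pi.single j (t : UnitAddCircle))))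
      (D (β + Pi.single i (Pi.single j 1)) m y) 0

namespace HasCrossedDerivs

variable {W W' : ProbTorus d → (Fin ℓ → Torus d) → ℝ}

lemma continuous (h : HasCrossedDerivs W) :
    Continuous fun p : ProbTorus d × (Fin ℓ → Torus d) => W p.1 p.2 := by
  obtain ⟨D, rfl, hcont, -⟩ := h
  exact hcont 0

lemma zero : HasCrossedDerivs fun (_ : ProbTorus d) (_ : Fin ℓ → Torus d) => 0 :=
  ⟨fun _ _ _ => 0, rfl, fun _ => continuous_const, fun _ _ _ _ _ => hasDerivAt_const _ _⟩

lemma add (h : HasCrossedDerivs W) (h' : HasCrossedDerivs W') :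
    HasCrossedDerivs fun m y => W m y + W' m y := by
  obtain ⟨D, rfl, hcont, hderiv⟩ := h
  obtain ⟨D', rfl, hcont', hderiv'⟩ := h'
  exact ⟨fun β m y => D β m y + D' β m y, rfl, fun β => (hcont β).add (hcont' β),
    fun β i j m y => (hderiv β i j m y).add (hderiv' β i j m y)⟩

lemma const_mul (h : HasCrossedDerivs W) (c : ℝ) : HasCrossedDerivs fun m y => c * W m y := by
  obtain ⟨D, rfl, hcont, hderiv⟩ := h
  exact ⟨fun β m y => c * D β m y, rfl, fun β => continuous_const.mul (hcont β),
    fun β i j m y => (hderiv β i j m y).const_mul c⟩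

lemma prod_mul {g : Fin ℓ → C(Torus d, ℝ)} (hg : ∀ i, IsSmoothOnTorus (g i)) {φ : ProbTorus d → ℝ}
    (hφ : Continuous φ) : HasCrossedDerivs fun m y => (∏ i, g i (y i)) * φ m := by
  choose D hzero hderiv using hg
  refine ⟨fun β m y => (∏ i, D i (β i) (y i)) * φ m, by simp [hzero], fun β => by fun_prop,
    fun β i j m y => HasDerivAt.mul_const ?_ _⟩
  simp only [add_single_eq_update, prod_apply_update fun i' (b : Fin d → ℕ) => D i' b (y i'),
    prod_apply_update fun i' => ⇑(D i' (β i'))]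
  simp only [← add_single_eq_update]
  exact (hderiv i (β i) j (y i)).mul_const _

end HasCrossedDerivs

end CrossedDerivatives

section PolynomialFunctional

variable {d ℓ N : ℕ}

/-- The tensor product of functions of one variable, in two groups of variables. -/
def tensorKernel (g : Fin ℓ → C(Torus d, ℝ)) (h : Fin N → C(Torus d, ℝ)) :
    (Fin ℓ → Torus d) → (Fin N → Torus d) → ℝ :=
  fun y x => (∏ i, g i (y i)) * ∏ r, h r (x r)

variable (d ℓ N) in
/-- The kernels which are finite sums of tensor products of smooth functions of one variable. -/
def tensorSpan : Submodule ℝ ((Fin ℓ → Torus d) → (Fin N → Torus d) → ℝ) :=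
  Submodule.span ℝ {K | ∃ g h, (∀ i, IsSmoothOnTorus (g i)) ∧ (∀ r, IsSmoothOnTorus (h r)) ∧
    tensorKernel g h = K}

lemma tensorKernel_mem_tensorSpan {g : Fin ℓ → C(Torus d, ℝ)} (hg : ∀ i, IsSmoothOnTorus (g i))
    {h : Fin N → C(Torus d, ℝ)} (hh : ∀ r, IsSmoothOnTorus (h r)) :
    tensorKernel g h ∈ tensorSpan d ℓ N :=
  Submodule.subset_span ⟨g, h, hg, hh, rfl⟩

lemma continuous_of_mem_tensorSpan {K : (Fin ℓ → Torus d) → (Fin N → Torus d) → ℝ}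
    (hK : K ∈ tensorSpan d ℓ N) (y : Fin ℓ → Torus d) : Continuous (K y) := by
  induction hK using Submodule.span_induction with
  | mem K hK => obtain ⟨g, h, -, -, rfl⟩ := hK; unfold tensorKernel; fun_prop
  | zero => exact continuous_const
  | add K K' _ _ hcont hcont' => exact hcont.add hcont'
  | smul c K _ hcont => exact hcont.const_smul c

/-- The polynomial functional `m ↦ ∫ K(y, x) m^{⊗ N}(dx)` with parameter `y`. -/
noncomputable def polyFunctional (K : (Fin ℓ → Torus d) → (Fin N → Torus d) → ℝ)
    (m : ProbTorus d) (y : Fin ℓ → Torus d) : ℝ :=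
  ∫ x, K y x ∂Measure.pi fun _ : Fin N => (m : Measure (Torus d))

lemma polyFunctional_zero (m : ProbTorus d) (y : Fin ℓ → Torus d) :
    polyFunctional (0 : (Fin ℓ → Torus d) → (Fin N → Torus d) → ℝ) m y = 0 :=
  integral_zero _ _

lemma polyFunctional_smul (c : ℝ) (K : (Fin ℓ → Torus d) → (Fin N → Torus d) → ℝ)
    (m : ProbTorus d) (y : Fin ℓ → Torus d) :
    polyFunctional (c • K) m y = c * polyFunctional K m y :=
  integral_const_mul c _

lemma polyFunctional_add {K K' : (Fin ℓ → Torus d) → (Fin N → Torus d) → ℝ}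
    (hK : K ∈ tensorSpan d ℓ N) (hK' : K' ∈ tensorSpan d ℓ N) (m : ProbTorus d)
    (y : Fin ℓ → Torus d) :
    polyFunctional (K + K') m y = polyFunctional K m y + polyFunctional K' m y :=
  integral_add (integrable_of_continuous (continuous_of_mem_tensorSpan hK y))
    (integrable_of_continuous (continuous_of_mem_tensorSpan hK' y))

lemma polyFunctional_sub {K K' : (Fin ℓ → Torus d) → (Fin N → Torus d) → ℝ}
    (hK : K ∈ tensorSpan d ℓ N) (hK' : K' ∈ tensorSpan d ℓ N) (m : ProbTorus d)
    (y : Fin ℓ → Torus d) :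
    polyFunctional (K - K') m y = polyFunctional K m y - polyFunctional K' m y :=
  integral_sub (integrable_of_continuous (continuous_of_mem_tensorSpan hK y))
    (integrable_of_continuous (continuous_of_mem_tensorSpan hK' y))

lemma polyFunctional_sum {ι : Type*} (S : Finset ι)
    {K : ι → (Fin ℓ → Torus d) → (Fin N → Torus d) → ℝ} (hK : ∀ r, K r ∈ tensorSpan d ℓ N)
    (m : ProbTorus d) (y : Fin ℓ → Torus d) :
    polyFunctional (∑ r ∈ S, K r) m y = ∑ r ∈ S, polyFunctional (K r) m y := by
  simp only [polyFunctional, Finset.sum_apply]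
  exact integral_finsetSum _ fun r _ =>
    integrable_of_continuous (continuous_of_mem_tensorSpan (hK r) y)

lemma polyFunctional_tensorKernel (g : Fin ℓ → C(Torus d, ℝ)) (h : Fin N → C(Torus d, ℝ))
    (m : ProbTorus d) (y : Fin ℓ → Torus d) :
    polyFunctional (tensorKernel g h) m y =
      (∏ i, g i (y i)) * ∏ r, ∫ x, h r x ∂(m : Measure (Torus d)) := by
  unfold polyFunctional tensorKernel
  rw [integral_const_mul, integral_fintype_prod_eq_prod fun r => ⇑(h r)]

lemma hasCrossedDerivs_polyFunctional {K : (Fin ℓ → Torus d) → (Fin N → Torus d) → ℝ}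
    (hK : K ∈ tensorSpan d ℓ N) : HasCrossedDerivs (polyFunctional K) := by
  induction hK using Submodule.span_induction with
  | mem K hK =>
    obtain ⟨g, h, hg, -, rfl⟩ := hK
    rw [funext₂ (polyFunctional_tensorKernel g h)]
    exact HasCrossedDerivs.prod_mul hg
      (continuous_finsetProd _ fun r _ => continuous_integral_probTorus (h r).continuous)
  | zero => rw [funext₂ polyFunctional_zero]; exact HasCrossedDerivs.zero
  | add K K' hK hK' h h' => rw [funext₂ (polyFunctional_add hK hK')]; exact h.add h'
  | smul c K _ h => rw [funext₂ (polyFunctional_smul c K)]; exact h.const_mul c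

lemma continuous_polyFunctional_snoc {K : (Fin (ℓ + 1) → Torus d) → (Fin N → Torus d) → ℝ}
    (hK : K ∈ tensorSpan d (ℓ + 1) N) (y : Fin ℓ → Torus d) :
    Continuous fun p : ProbTorus d × Torus d =>
      polyFunctional K p.1 (Fin.snoc y p.2 : Fin (ℓ + 1) → Torus d) :=
  (hasCrossedDerivs_polyFunctional hK).continuous.comp
    (continuous_fst.prodMk (continuous_const.finSnoc continuous_snd))

end PolynomialFunctional

section FlatKernel

variable {X : Type*} {ℓ N : ℕ}

/-- The kernel of the normalised flat derivative of the functional `m ↦ ∫ K(y, x) m^{⊗ N}(dx)`: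
one of the variables `x_r` is replaced by the new variable, which is the last one of `y`. -/
def flatKernel : ((Fin ℓ → X) → (Fin N → X) → ℝ) →ₗ[ℝ] (Fin (ℓ + 1) → X) → (Fin N → X) → ℝ where
  toFun K y x := ∑ r, (K (Fin.init y) (Function.update x r (y (Fin.last ℓ))) - K (Fin.init y) x)
  map_add' K K' := by
    ext y x
    simp only [Pi.add_apply, add_sub_add_comm, Finset.sum_add_distrib]
  map_smul' c K := by
    ext y x
    simp only [Pi.smul_apply, RingHom.id_apply, ← smul_sub, Finset.smul_sum]

lemma flatKernel_apply (K : (Fin ℓ → X) → (Fin N → X) → ℝ) (y : Fin (ℓ + 1) → X) (x : Fin N → X) :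
    flatKernel K y x =
      ∑ r, (K (Fin.init y) (Function.update x r (y (Fin.last ℓ))) - K (Fin.init y) x) :=
  rfl

/-- The kernels of the successive flat derivatives of the functional `m ↦ ∫ H dm^{⊗ N}`. -/
def flatKernelSeq (H : (Fin N → X) → ℝ) : (ℓ : ℕ) → (Fin ℓ → X) → (Fin N → X) → ℝ
  | 0 => fun _ => H
  | ℓ + 1 => flatKernel (flatKernelSeq H ℓ)

end FlatKernel

section FlatDerivative

variable {d ℓ N : ℕ}

lemma prod_sub_prod_eq_integral (A B : Fin N → ℝ) :
    ∏ r, B r - ∏ r, A r = ∫ s : unitInterval,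
      ∑ r, (B r - A r) * ∏ r' ∈ Finset.univ.erase r, ((1 - (s : ℝ)) * A r' + s * B r') := by
  let P' : ℝ → ℝ := fun s =>
    ∑ r, (B r - A r) * ∏ r' ∈ Finset.univ.erase r, ((1 - s) * A r' + s * B r')
  have hfactor (s : ℝ) (r : Fin N) :
      HasDerivAt (fun s : ℝ => (1 - s) * A r + s * B r) (B r - A r) s :=
    ((((hasDerivAt_id s).const_sub 1).mul_const (A r)).add
      ((hasDerivAt_id s).mul_const (B r))).congr_deriv (by ring)
  have hprod (s : ℝ) : HasDerivAt (fun s : ℝ => ∏ r, ((1 - s) * A r + s * B r)) (P' s) s :=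
    (HasDerivAt.fun_finsetProd fun r _ => hfactor s r).congr_deriv
      (Finset.sum_congr rfl fun r _ => by rw [smul_eq_mul, mul_comm])
  have hinterval : ∫ s : unitInterval, P' s = ∫ s in (0 : ℝ)..1, P' s := by
    rw [intervalIntegral.integral_of_le zero_le_one, ← integral_Icc_eq_integral_Ioc]
    exact integral_subtype_comap measurableSet_Icc P'
  rw [hinterval, intervalIntegral.integral_eq_sub_of_hasDerivAt (fun s _ => hprod s)
    (Continuous.intervalIntegrable (by fun_prop) _ _)]
  simp

lemma tensorKernel_snoc (g : Fin ℓ → C(Torus d, ℝ)) (f : C(Torus d, ℝ)) (h : Fin N → C(Torus d, ℝ))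
    (y : Fin (ℓ + 1) → Torus d) (x : Fin N → Torus d) :
    tensorKernel (Fin.snoc g f : Fin (ℓ + 1) → C(Torus d, ℝ)) h y x =
      f (y (Fin.last ℓ)) * tensorKernel g h (Fin.init y) x := by
  simp only [tensorKernel, Fin.prod_univ_castSucc, Fin.snoc_castSucc, Fin.snoc_last, Fin.init]
  ring

lemma flatKernel_tensorKernel (g : Fin ℓ → C(Torus d, ℝ)) (h : Fin N → C(Torus d, ℝ)) :
    flatKernel (tensorKernel g h) =
      ∑ r, (tensorKernel (Fin.snoc g (h r) : Fin (ℓ + 1) → C(Torus d, ℝ)) (Function.update h r 1) -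
        tensorKernel (Fin.snoc g 1 : Fin (ℓ + 1) → C(Torus d, ℝ)) h) := by
  ext y x
  simp only [flatKernel_apply, Finset.sum_apply, Pi.sub_apply, tensorKernel_snoc,
    ContinuousMap.one_apply, one_mul]
  simp only [tensorKernel, prod_apply_update fun r => ⇑(h r),
    prod_apply_update fun r (f : C(Torus d, ℝ)) => f (x r), ContinuousMap.one_apply, one_mul]
  exact Finset.sum_congr rfl fun r _ => by ring

lemma isSmoothOnTorus_snoc {g : Fin ℓ → C(Torus d, ℝ)} (hg : ∀ i, IsSmoothOnTorus (g i))
    {f : C(Torus d, ℝ)} (hf : IsSmoothOnTorus f) (i : Fin (ℓ + 1)) :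
    IsSmoothOnTorus ((Fin.snoc g f : Fin (ℓ + 1) → C(Torus d, ℝ)) i) := by
  induction i using Fin.lastCases with
  | last => simpa only [Fin.snoc_last] using hf
  | cast i => simpa only [Fin.snoc_castSucc] using hg i

lemma isSmoothOnTorus_update_one {h : Fin N → C(Torus d, ℝ)} (hh : ∀ r, IsSmoothOnTorus (h r))
    (r r' : Fin N) : IsSmoothOnTorus (Function.update h r 1 r') :=
  (Function.forall_update_iff h fun _ f => IsSmoothOnTorus f).2
    ⟨isSmoothOnTorus_one, fun i _ => hh i⟩ r'

lemma flatKernel_mem_tensorSpan {K : (Fin ℓ → Torus d) → (Fin N → Torus d) → ℝ}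
    (hK : K ∈ tensorSpan d ℓ N) : flatKernel K ∈ tensorSpan d (ℓ + 1) N := by
  induction hK using Submodule.span_induction with
  | mem K hK =>
    obtain ⟨g, h, hg, hh, rfl⟩ := hK
    rw [flatKernel_tensorKernel]
    exact Submodule.sum_mem _ fun r _ => Submodule.sub_mem _
      (tensorKernel_mem_tensorSpan (isSmoothOnTorus_snoc hg (hh r))
        (isSmoothOnTorus_update_one hh r))
      (tensorKernel_mem_tensorSpan (isSmoothOnTorus_snoc hg isSmoothOnTorus_one) hh)
  | zero => rw [map_zero]; exact Submodule.zero_mem _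
  | add K K' _ _ h h' => rw [map_add]; exact Submodule.add_mem _ h h'
  | smul c K _ h => rw [map_smul]; exact Submodule.smul_mem _ c h

lemma polyFunctional_flatKernel_tensorKernel {g : Fin ℓ → C(Torus d, ℝ)}
    (hg : ∀ i, IsSmoothOnTorus (g i)) {h : Fin N → C(Torus d, ℝ)} (hh : ∀ r, IsSmoothOnTorus (h r))
    (m : ProbTorus d) (y : Fin ℓ → Torus d) (y' : Torus d) :
    polyFunctional (flatKernel (tensorKernel g h)) m (Fin.snoc y y' : Fin (ℓ + 1) → Torus d) =
      (∏ i, g i (y i)) * ∑ r, (h r y' - ∫ x, h r x ∂(m : Measure (Torus d))) *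
        ∏ r' ∈ Finset.univ.erase r, ∫ x, h r' x ∂(m : Measure (Torus d)) := by
  have hleft (r : Fin N) := tensorKernel_mem_tensorSpan (isSmoothOnTorus_snoc hg (hh r))
    (isSmoothOnTorus_update_one hh r)
  have hright := tensorKernel_mem_tensorSpan (isSmoothOnTorus_snoc hg isSmoothOnTorus_one) hh
  rw [flatKernel_tensorKernel, polyFunctional_sum _ fun r => Submodule.sub_mem _ (hleft r) hright,
    Finset.mul_sum]
  refine Finset.sum_congr rfl fun r _ => ?_
  rw [polyFunctional_sub (hleft r) hright, polyFunctional_tensorKernel, polyFunctional_tensorKernel,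
    prod_apply_update fun _ (f : C(Torus d, ℝ)) => ∫ x, f x ∂(m : Measure (Torus d)),
    ← Finset.mul_prod_erase _ (fun r => ∫ x, h r x ∂(m : Measure (Torus d))) (Finset.mem_univ r)]
  simp only [Fin.prod_univ_castSucc, Fin.snoc_castSucc, Fin.snoc_last, ContinuousMap.one_apply,
    integral_const, probReal_univ, one_smul]
  ring

lemma integral_polyFunctional_flatKernel_tensorKernel {g : Fin ℓ → C(Torus d, ℝ)}
    (hg : ∀ i, IsSmoothOnTorus (g i)) {h : Fin N → C(Torus d, ℝ)} (hh : ∀ r, IsSmoothOnTorus (h r))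
    (m n : ProbTorus d) (y : Fin ℓ → Torus d) :
    ∫ y', polyFunctional (flatKernel (tensorKernel g h)) m (Fin.snoc y y' : Fin (ℓ + 1) → Torus d)
        ∂(n : Measure (Torus d)) =
      (∏ i, g i (y i)) * ∑ r, (∫ x, h r x ∂(n : Measure (Torus d)) -
          ∫ x, h r x ∂(m : Measure (Torus d))) *
        ∏ r' ∈ Finset.univ.erase r, ∫ x, h r' x ∂(m : Measure (Torus d)) := by
  simp_rw [polyFunctional_flatKernel_tensorKernel hg hh]
  rw [integral_const_mul, integral_finsetSum _ fun r _ => integrable_of_continuous (by fun_prop)]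
  congr 1
  refine Finset.sum_congr rfl fun r _ => ?_
  rw [integral_mul_const, integral_sub (integrable_of_continuous (h r).continuous)
    (integrable_const _), integral_const, probReal_univ, one_smul]

lemma isLinearDeriv_polyFunctional {K : (Fin ℓ → Torus d) → (Fin N → Torus d) → ℝ}
    (hK : K ∈ tensorSpan d ℓ N) (y : Fin ℓ → Torus d) :
    IsLinearDeriv (fun m => polyFunctional K m y)
      (fun m y' => polyFunctional (flatKernel K) m (Fin.snoc y y' : Fin (ℓ + 1) → Torus d)) := by
  induction hK using Submodule.span_induction with
  | mem K hK =>
    refine ⟨continuous_polyFunctional_snoc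
      (flatKernel_mem_tensorSpan (Submodule.subset_span hK)) y, fun m m' => ?_⟩
    obtain ⟨g, h, hg, hh, rfl⟩ := hK
    simp_rw [integral_polyFunctional_flatKernel_tensorKernel hg hh, polyFunctional_tensorKernel,
      ← mul_sub, ← Finset.sum_sub_distrib, ← sub_mul, sub_sub_sub_cancel_right]
    rw [integral_const_mul, prod_sub_prod_eq_integral]
    simp_rw [integral_mixture _ m m' (h _).continuous]
  | zero => simpa only [map_zero, polyFunctional_zero] using IsLinearDeriv.zero
  | add K K' hK hK' h h' =>
    simpa only [map_add, polyFunctional_add hK hK', polyFunctional_add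
      (flatKernel_mem_tensorSpan hK) (flatKernel_mem_tensorSpan hK')] using h.add h'
  | smul c K _ h => simpa only [map_smul, polyFunctional_smul] using h.const_mul c

lemma integral_polyFunctional_flatKernel_eq_zero {K : (Fin ℓ → Torus d) → (Fin N → Torus d) → ℝ}
    (hK : K ∈ tensorSpan d ℓ N) (m : ProbTorus d) (y : Fin ℓ → Torus d) :
    ∫ y', polyFunctional (flatKernel K) m (Fin.snoc y y' : Fin (ℓ + 1) → Torus d)
      ∂(m : Measure (Torus d)) = 0 := by
  have hint {K : (Fin ℓ → Torus d) → (Fin N → Torus d) → ℝ} (hK : K ∈ tensorSpan d ℓ N) :=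
    integrable_of_continuous (μ := (m : Measure (Torus d)))
      ((isLinearDeriv_polyFunctional hK y).continuous_deriv_apply m)
  induction hK using Submodule.span_induction with
  | mem K hK =>
    obtain ⟨g, h, hg, hh, rfl⟩ := hK
    simp only [integral_polyFunctional_flatKernel_tensorKernel hg hh, sub_self, zero_mul,
      Finset.sum_const_zero, mul_zero]
  | zero => simp only [map_zero, polyFunctional_zero, integral_zero]
  | add K K' hK hK' h h' =>
    simp only [map_add, polyFunctional_add (flatKernel_mem_tensorSpan hK)
      (flatKernel_mem_tensorSpan hK')]
    rw [integral_add (hint hK) (hint hK'), h, h', add_zero]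
  | smul c K _ h => simp only [map_smul, polyFunctional_smul, integral_const_mul, h, mul_zero]

variable {H : (Fin N → Torus d) → ℝ}

lemma flatKernelSeq_mem_tensorSpan (hH : (fun _ => H) ∈ tensorSpan d 0 N) :
    ∀ ℓ, flatKernelSeq H ℓ ∈ tensorSpan d ℓ N
  | 0 => hH
  | ℓ + 1 => flatKernel_mem_tensorSpan (flatKernelSeq_mem_tensorSpan hH ℓ)

lemma isFlatDeriv_polyFunctional (hH : (fun _ => H) ∈ tensorSpan d 0 N) (k : ℕ) :
    IsFlatDeriv k (fun m : ProbTorus d => ∫ x, H x ∂Measure.pi fun _ => (m : Measure (Torus d)))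
      fun ℓ => polyFunctional (flatKernelSeq H ℓ) where
  zero _ _ := rfl
  continuous ℓ _ := (hasCrossedDerivs_polyFunctional (flatKernelSeq_mem_tensorSpan hH ℓ)).continuous
  sub_eq_integral ℓ _ m m' y :=
    (isLinearDeriv_polyFunctional (flatKernelSeq_mem_tensorSpan hH ℓ) y).sub_eq m m'
  integral_eq_zero ℓ _ m y :=
    integral_polyFunctional_flatKernel_eq_zero (flatKernelSeq_mem_tensorSpan hH ℓ) m y

end FlatDerivative

section Criteria

variable {d : ℕ} {k : ℕ} {Φ : ProbTorus d → ℝ}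
  {V : (ℓ : ℕ) → ProbTorus d → (Fin ℓ → Torus d) → ℝ}

lemma finite_setOf_admissible (d ℓ n : ℕ) : {β : Fin ℓ → Fin d → ℕ | Admissible n β}.Finite :=
  (Set.finite_Iic fun _ _ => n).subset fun β hβ i j =>
    (Finset.single_le_sum (f := β i) (fun _ _ => Nat.zero_le _) (Finset.mem_univ j)).trans (hβ i)

lemma not_admissible_zero_add_single {ℓ : ℕ} (β : Fin ℓ → Fin d → ℕ) (i : Fin ℓ) (j : Fin d) :
    ¬ Admissible 0 (β + Pi.single i (Pi.single j 1)) := fun h => by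
  have hle := (Finset.single_le_sum (f := (β + Pi.single i (Pi.single j 1) : _ → Fin d → ℕ) i)
    (fun _ _ => Nat.zero_le _) (Finset.mem_univ j)).trans (h i)
  simp only [Pi.add_apply, Pi.single_eq_same] at hle
  omega

lemma smoothFunctional_of_hasCrossedDerivs (hV : ∀ k, IsFlatDeriv k Φ V)
    (hcrossed : ∀ ℓ, HasCrossedDerivs (V ℓ)) : SmoothFunctional Φ := by
  intro n k
  choose D hzero hcont hderiv using hcrossed
  choose B hB using fun ℓ β => exists_abs_le_of_continuous (hcont ℓ β)
  choose E hE using fun ℓ => ((finite_setOf_admissible d ℓ n).image (B ℓ)).bddAbove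
  obtain ⟨C, hC⟩ := ((Set.finite_Iic k).image E).bddAbove
  refine ⟨C, V, hV k, fun ℓ hℓ => ⟨D ℓ, fun m => ⟨congrFun (hzero ℓ) m,
    fun β _ => (hcont ℓ β).comp (Continuous.prodMk_right m), fun β i j _ y => hderiv ℓ β i j m y⟩,
    fun β hβ => ⟨fun m y => ?_, uniformEquicontinuous_of_continuous (hcont ℓ β), fun hpos => ?_⟩⟩⟩
  · rw [Nat.floor_natCast] at hβ
    exact (hB ℓ β (m, y)).trans ((hE ℓ ⟨β, hβ, rfl⟩).trans (hC ⟨ℓ, hℓ, rfl⟩))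
  · rw [Nat.floor_natCast, sub_self] at hpos
    exact absurd hpos (lt_irrefl 0)

lemma intPhiBound_iff_of_lt_one {α C : ℝ} (hα : α < 1) : IntPhiBound α k C Φ ↔
    ∃ V : (ℓ : ℕ) → ProbTorus d → (Fin ℓ → Torus d) → ℝ, IsFlatDeriv k Φ V ∧
      ∀ ℓ ≤ k, (∀ m y, |V ℓ m y| ≤ C) ∧
        (0 < α → ∀ m y z, |V ℓ m y - V ℓ m z| ≤ C * dist y z ^ α) := by
  simp only [IntPhiBound, Nat.floor_eq_zero.2 hα, Nat.cast_zero, sub_zero]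
  refine exists_congr fun V => and_congr_right fun hV => forall₂_congr fun ℓ hℓ => ⟨?_, ?_⟩
  · rintro ⟨D, hD, hbound⟩
    have hV_eq : D 0 = V ℓ := funext fun m => (hD m).zero
    obtain ⟨hle, -, hholder⟩ := hbound 0 fun _ => by simp
    rw [hV_eq] at hle hholder
    exact ⟨hle, hholder⟩
  · rintro ⟨hle, hholder⟩
    exact ⟨fun _ => V ℓ, fun m => ⟨rfl,
      fun _ _ => (hV.continuous ℓ hℓ).comp (Continuous.prodMk_right m),
      fun β i j hβ => absurd hβ (not_admissible_zero_add_single β i j)⟩,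
      fun _ _ => ⟨hle, uniformEquicontinuous_of_continuous (hV.continuous ℓ hℓ), hholder⟩⟩

namespace IsFlatDeriv

lemma isLinearDeriv (hV : IsFlatDeriv k Φ V) {ℓ : ℕ} (hℓ : ℓ < k) (y : Fin ℓ → Torus d) :
    IsLinearDeriv (fun m => V ℓ m y)
      fun m y' => V (ℓ + 1) m (Fin.snoc y y' : Fin (ℓ + 1) → Torus d) where
  continuous_deriv := (hV.continuous (ℓ + 1) hℓ).comp
    (continuous_fst.prodMk (continuous_const.finSnoc continuous_snd))
  sub_eq m m' := hV.sub_eq_integral ℓ hℓ m m' y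

lemma isLinearDeriv_zero (hV : IsFlatDeriv k Φ V) (hk : 0 < k) :
    IsLinearDeriv Φ fun m a => V 1 m ![a] := by
  convert hV.isLinearDeriv hk ![] using 3 with m m a
  · exact (hV.zero m ![]).symm
  · refine congrArg (V 1 m) (funext fun i => ?_)
    fin_cases i
    rfl

lemma isLinearDeriv_one (hV : IsFlatDeriv k Φ V) (hk : 1 < k) (a : Torus d) :
    IsLinearDeriv (fun m => V 1 m ![a]) fun m b => V 2 m ![a, b] := by
  convert hV.isLinearDeriv hk ![a] using 3 with m b
  refine congrArg (V 2 m) (funext fun i => ?_)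
  fin_cases i <;> rfl

end IsFlatDeriv

end Criteria

section Differences

variable {X : Type*} {N : ℕ}

/-- First and mixed second differences of `F` are controlled by `w` with the scaling of a function
of the average of `N` terms. -/
structure HasDiffBound (F : (Fin N → X) → ℝ) (w : X → X → ℝ) : Prop where
  first : ∀ x i a a', |F (Function.update x i a) - F (Function.update x i a')| ≤ w a a' / N
  second : ∀ x i j, i ≠ j → ∀ a a' b b',
    |(F (Function.update (Function.update x j b) i a) -
        F (Function.update (Function.update x j b) i a')) -
      (F (Function.update (Function.update x j b') i a) -
        F (Function.update (Function.update x j b') i a'))| ≤ 2 * w a a' / N / N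

/-- The mixed second difference at the coordinates `i`, `j`, relative to the point `x`. -/
def mixedDiff (F : (Fin N → X) → ℝ) (x : Fin N → X) (i j : Fin N) (a b : X) : ℝ :=
  (F (Function.update (Function.update x j b) i a) - F (Function.update x j b)) -
    (F (Function.update x i a) - F x)

variable {F : (Fin N → X) → ℝ} {w : X → X → ℝ}

lemma mixedDiff_self (x : Fin N → X) (i : Fin N) (a b : X) :
    mixedDiff F x i i a b = F x - F (Function.update x i b) := by
  simp only [mixedDiff, Function.update_idem]
  ring

lemma mixedDiff_eq_zero (x : Fin N → X) (i j : Fin N) : mixedDiff F x i j (x i) (x j) = 0 := by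
  simp only [mixedDiff, Function.update_eq_self, sub_self]

lemma flatKernelSeq_one (y : Fin 1 → X) (x : Fin N → X) :
    flatKernelSeq F 1 y x = ∑ i, (F (Function.update x i (y 0)) - F x) :=
  rfl

lemma flatKernelSeq_two (y : Fin 2 → X) (x : Fin N → X) :
    flatKernelSeq F 2 y x = ∑ j, ∑ i, mixedDiff F x i j (y 0) (y 1) := by
  simp only [mixedDiff, Finset.sum_sub_distrib (fun _ => _ - _)]
  rfl

lemma sum_sum_ite_diagonal [NeZero N] (A B : ℝ) :
    ∑ j : Fin N, ∑ i : Fin N, (A / N / N + if i = j then B / N else 0) = A + B := by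
  have hN : (N : ℝ) ≠ 0 := NeZero.ne _
  simp only [Finset.sum_add_distrib, Finset.sum_ite_eq', Finset.mem_univ, if_true,
    Finset.sum_const, Finset.card_univ, Fintype.card_fin, nsmul_eq_mul, mul_div_cancel₀ _ hN]

namespace HasDiffBound

lemma abs_mixedDiff_sub_le (h : HasDiffBound F w) (hw : ∀ a a', 0 ≤ w a a') (x : Fin N → X)
    (i j : Fin N) (a a' b b' : X) :
    |mixedDiff F x i j a b - mixedDiff F x i j a' b'| ≤
      (2 * w a a' + 2 * w b b') / N / N + if i = j then w b b' / N else 0 := by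
  obtain rfl | hij := eq_or_ne i j
  · rw [mixedDiff_self, mixedDiff_self, sub_sub_sub_cancel_left, abs_sub_comm, if_pos rfl]
    refine (h.first x i b b').trans (le_add_of_nonneg_left ?_)
    have := hw a a'
    have := hw b b'
    positivity
  · have hfirst := h.second x i j hij a a' b (x j)
    have hsecond := h.second x j i hij.symm b b' a' (x i)
    have hcomm (c : X) := Function.update_comm hij a' c x
    simp only [Function.update_eq_self] at hfirst
    simp only [hcomm, Function.update_eq_self] at hsecond
    rw [if_neg hij, add_zero, add_div, add_div]
    refine le_trans (le_of_eq (congrArg _ ?_)) ((abs_add_le _ _).trans (add_le_add hfirst hsecond))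
    simp only [mixedDiff]
    ring

lemma abs_flatKernelSeq_one_sub_le [NeZero N] (h : HasDiffBound F w) (y y' : Fin 1 → X)
    (x : Fin N → X) :
    |flatKernelSeq F 1 y x - flatKernelSeq F 1 y' x| ≤ w (y 0) (y' 0) := by
  simp only [flatKernelSeq_one, ← Finset.sum_sub_distrib, sub_sub_sub_cancel_right]
  calc _ ≤ ∑ i, |F (Function.update x i (y 0)) - F (Function.update x i (y' 0))| :=
        Finset.abs_sum_le_sum_abs _ _
    _ ≤ ∑ _ : Fin N, w (y 0) (y' 0) / N := Finset.sum_le_sum fun i _ => h.first x i _ _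
    _ = w (y 0) (y' 0) := by simp [mul_div_cancel₀ _ (NeZero.ne (N : ℝ))]

lemma abs_flatKernelSeq_two_sub_le [NeZero N] (h : HasDiffBound F w) (hw : ∀ a a', 0 ≤ w a a')
    (y y' : Fin 2 → X) (x : Fin N → X) :
    |flatKernelSeq F 2 y x - flatKernelSeq F 2 y' x| ≤ 2 * w (y 0) (y' 0) + 3 * w (y 1) (y' 1) := by
  simp only [flatKernelSeq_two, ← Finset.sum_sub_distrib]
  refine ((Finset.abs_sum_le_sum_abs _ _).trans (Finset.sum_le_sum fun j _ =>
    (Finset.abs_sum_le_sum_abs _ _).trans (Finset.sum_le_sum fun i _ =>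
      h.abs_mixedDiff_sub_le hw x i j _ _ _ _))).trans_eq ?_
  rw [sum_sum_ite_diagonal]
  ring

lemma abs_flatKernelSeq_one_le [NeZero N] {W : ℝ} (h : HasDiffBound F fun _ _ => W)
    (y : Fin 1 → X) (x : Fin N → X) : |flatKernelSeq F 1 y x| ≤ W := by
  have hterm (i : Fin N) : |F (Function.update x i (y 0)) - F x| ≤ W / N := by
    simpa only [Function.update_eq_self] using h.first x i (y 0) (x i)
  rw [flatKernelSeq_one]
  calc _ ≤ ∑ i, |F (Function.update x i (y 0)) - F x| := Finset.abs_sum_le_sum_abs _ _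
    _ ≤ ∑ _ : Fin N, W / N := Finset.sum_le_sum fun i _ => hterm i
    _ = W := by simp [mul_div_cancel₀ _ (NeZero.ne (N : ℝ))]

lemma abs_flatKernelSeq_two_le [NeZero N] {W : ℝ} (hW : 0 ≤ W)
    (h : HasDiffBound F fun _ _ => W) (y : Fin 2 → X) (x : Fin N → X) :
    |flatKernelSeq F 2 y x| ≤ 5 * W := by
  have hterm (i j : Fin N) : |mixedDiff F x i j (y 0) (y 1)| ≤
      (2 * W + 2 * W) / N / N + if i = j then W / N else 0 := by
    simpa only [mixedDiff_eq_zero, sub_zero] using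
      h.abs_mixedDiff_sub_le (fun _ _ => hW) x i j (y 0) (x i) (y 1) (x j)
  rw [flatKernelSeq_two]
  refine ((Finset.abs_sum_le_sum_abs _ _).trans (Finset.sum_le_sum fun j _ =>
    (Finset.abs_sum_le_sum_abs _ _).trans (Finset.sum_le_sum fun i _ => hterm i j))).trans_eq ?_
  rw [sum_sum_ite_diagonal]
  ring

end HasDiffBound

end Differences

section DifferenceBounds

variable {d N : ℕ} {F : (Fin N → Torus d) → ℝ} {w : Torus d → Torus d → ℝ}

lemma hasDiffBound_empiricalMeasure [NeZero N] {U : ProbTorus d → ℝ}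
    {U₁ : ProbTorus d → Torus d → ℝ} {U₂ : ProbTorus d → Torus d → Torus d → ℝ}
    (h₁ : IsLinearDeriv U U₁) (h₂ : ∀ a, IsLinearDeriv (fun m => U₁ m a) fun m => U₂ m a)
    (hw₁ : ∀ n a a', |U₁ n a - U₁ n a'| ≤ w a a')
    (hw₂ : ∀ n a a' b, |U₂ n a b - U₂ n a' b| ≤ w a a') :
    HasDiffBound (fun z : Fin N → Torus d => U (empiricalMeasure z)) w where
  first x i a a' := by
    simp only [empiricalMeasure_update]
    exact h₁.abs_averageMeasure_update_diracProba_sub_le _ i fun n => hw₁ n a a'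
  second x i j hij a a' b b' := by
    have hupdate (c : Torus d) : (fun k => diracProba (Function.update x j c k)) =
        Function.update (fun k => diracProba (x k)) j (diracProba c) :=
      funext (Function.apply_update (fun _ => diracProba) x j c)
    simp only [empiricalMeasure_update, hupdate]
    refine h₁.abs_second_difference_averageMeasure_le h₂ _ hij fun n => ?_
    rw [two_mul]
    refine le_trans (le_of_eq (congrArg _ ?_))
      ((abs_sub _ _).trans (add_le_add (hw₂ n a a' b) (hw₂ n a a' b')))
    ring

lemma HasDiffBound.integral_add (hF : Continuous F) (h : HasDiffBound F w)
    (hw : ∀ a a' c, w (a + c) (a' + c) = w a a') (Q : Measure (Fin N → Torus d))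
    [IsProbabilityMeasure Q] : HasDiffBound (fun x => ∫ z, F (x + z) ∂Q) w := by
  have hint (x : Fin N → Torus d) : Integrable (fun z => F (x + z)) Q :=
    integrable_of_continuous (by fun_prop)
  refine ⟨fun x i a a' => ?_, fun x i j hij a a' b b' => ?_⟩
  · refine abs_integral_sub_integral_le (hint _) (hint _) fun z => ?_
    rw [update_add_apply, update_add_apply, ← hw a a' (z i)]
    exact h.first _ _ _ _
  · rw [← integral_sub (hint _) (hint _), ← integral_sub (hint _) (hint _)]
    refine abs_integral_sub_integral_le ((hint _).sub (hint _)) ((hint _).sub (hint _)) fun z => ?_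
    simp only [update_add_apply]
    rw [← hw a a' (z i)]
    exact h.second _ i j hij _ _ _ _

lemma intPhiBound_of_hasDiffBound [NeZero N] (hF : (fun _ => F) ∈ tensorSpan d 0 N) {α : ℝ}
    (hα : α < 1) {C : ℝ} (hC : 0 ≤ C) (hle : ∀ x, |F x| ≤ C)
    (hbound : HasDiffBound F fun _ _ => 2 * C)
    (hholder : 0 < α → HasDiffBound F fun a a' => C * dist a a' ^ α) :
    IntPhiBound α 2 (10 * C)
      fun m : ProbTorus d => ∫ x, F x ∂Measure.pi fun _ => (m : Measure (Torus d)) := by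
  refine (intPhiBound_iff_of_lt_one hα).2 ⟨_, isFlatDeriv_polyFunctional hF 2, fun ℓ hℓ =>
    ⟨fun m y => abs_integral_le_of_abs_le fun x => ?_, fun hpos m y z => ?_⟩⟩
  · interval_cases ℓ
    · exact (hle x).trans (by linarith)
    · exact (hbound.abs_flatKernelSeq_one_le y x).trans (by linarith)
    · exact (hbound.abs_flatKernelSeq_two_le (by positivity) y x).trans_eq (by ring)
  · have hcont := continuous_of_mem_tensorSpan (flatKernelSeq_mem_tensorSpan hF ℓ)
    refine abs_integral_sub_integral_le (integrable_of_continuous (hcont y))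
      (integrable_of_continuous (hcont z)) fun x => ?_
    have hdist (i : Fin ℓ) : C * dist (y i) (z i) ^ α ≤ C * dist y z ^ α := by
      gcongr
      exact dist_le_pi_dist y z i
    have hnonneg : 0 ≤ C * dist y z ^ α := by positivity
    interval_cases ℓ
    · simp only [flatKernelSeq, sub_self, abs_zero]
      positivity
    · exact ((hholder hpos).abs_flatKernelSeq_one_sub_le y z x).trans (by linarith [hdist 0])
    · exact ((hholder hpos).abs_flatKernelSeq_two_sub_le (fun _ _ => by positivity) y z x).trans
        (by linarith [hdist 0, hdist 1])

end DifferenceBounds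

section TrigDensity

variable {d : ℕ}

lemma mFourier_sub (k : Fin d → ℤ) (z x : Torus d) :
    UnitAddTorus.mFourier k (z - x) =
      UnitAddTorus.mFourier k z * (starRingEnd ℂ) (UnitAddTorus.mFourier k x) := by
  simp only [UnitAddTorus.mFourier, ContinuousMap.coe_mk, map_prod, ← Finset.prod_mul_distrib]
  refine Finset.prod_congr rfl fun i _ => ?_
  rw [← fourier_neg, fourier_apply, fourier_apply, fourier_apply, Pi.sub_apply, smul_sub, neg_smul,
    sub_eq_add_neg, AddCircle.toCircle_add, Circle.coe_mul]

lemma exists_re_sub_eq_sum {f : C(Torus d, ℂ)} (hf : f ∈ UnitAddTorus.mFourierSubalgebra (Fin d)) :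
    ∃ (ι : Type) (_ : Fintype ι) (c a : ι → C(Torus d, ℝ)), (∀ s, IsSmoothOnTorus (a s)) ∧
      ∀ z x, (f (z - x)).re = ∑ s, c s z * a s x := by
  have hspan : f ∈ Submodule.span ℂ (Set.range (UnitAddTorus.mFourier (d := Fin d))) := by
    rwa [← UnitAddTorus.mFourierSubalgebra_coe]
  obtain ⟨b, rfl⟩ := Finsupp.mem_span_range_iff_exists_finsupp.1 hspan
  let coeff : Bool → ℂ := fun s => if s then 1 else -Complex.I
  refine ⟨b.support × Bool, inferInstance,
    fun s => ⟨fun z => (coeff s.2 * (b s.1 * UnitAddTorus.mFourier s.1 z)).re, by fun_prop⟩,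
    fun s => ⟨fun x => (coeff s.2 * UnitAddTorus.mFourier s.1 x).re, by fun_prop⟩,
    fun s => isSmoothOnTorus_re_mul_mFourier _ _, fun z x => ?_⟩
  simp only [Fintype.sum_prod_type, Fintype.sum_bool, ContinuousMap.coe_mk, coeff, if_true,
    Bool.false_eq_true, if_false, one_mul]
  rw [Finset.sum_coe_sort b.support fun k =>
    (b k * UnitAddTorus.mFourier k z).re * (UnitAddTorus.mFourier k x).re +
      (-Complex.I * (b k * UnitAddTorus.mFourier k z)).re *
        (-Complex.I * UnitAddTorus.mFourier k x).re]
  simp only [Finsupp.sum, ContinuousMap.coe_sum, Finset.sum_apply, ContinuousMap.coe_smul,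
    Pi.smul_apply, smul_eq_mul, Complex.re_sum, mFourier_sub]
  refine Finset.sum_congr rfl fun k _ => ?_
  simp only [Complex.mul_re, Complex.mul_im, Complex.neg_re, Complex.neg_im, Complex.I_re,
    Complex.I_im, Complex.conj_re, Complex.conj_im]
  ring

/-- A trigonometric polynomial which is a probability density on the torus. -/
structure IsTrigDensity (ρ : Torus d → ℝ) : Prop where
  nonneg : ∀ x, 0 ≤ ρ x
  integral_eq_one : ∫ x, ρ x = 1
  exists_mem : ∃ f ∈ UnitAddTorus.mFourierSubalgebra (Fin d), ∀ x, (f x).re = ρ x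

lemma IsTrigDensity.continuous {ρ : Torus d → ℝ} (hρ : IsTrigDensity ρ) : Continuous ρ := by
  obtain ⟨f, -, hf⟩ := hρ.exists_mem
  exact (Complex.continuous_re.comp f.continuous).congr hf

/-- A real trigonometric polynomial which is positive, with a strict maximum at the origin. Its
normalised powers form an approximate identity. -/
noncomputable def peakFunction (x : Torus d) : ℝ := 1 + ∑ j, (2 + 2 * (fourier 1 (x j)).re)

lemma exists_mem_mFourierSubalgebra_eq_peakFunction :
    ∃ f ∈ UnitAddTorus.mFourierSubalgebra (Fin d), ∀ x, f x = (peakFunction x : ℂ) := by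
  let e (j : Fin d) : C(Torus d, ℂ) := UnitAddTorus.mFourier (Pi.single j 1)
  have he (j : Fin d) : e j ∈ UnitAddTorus.mFourierSubalgebra (Fin d) :=
    Algebra.subset_adjoin ⟨_, rfl⟩
  refine ⟨1 + ∑ j, ((2 : ℂ) • 1 + (e j + star (e j))), add_mem (one_mem _) (sum_mem fun j _ =>
    add_mem (Subalgebra.smul_mem _ (one_mem _) 2) (add_mem (he j) (star_mem (he j)))), fun x => ?_⟩
  simp [e, peakFunction, UnitAddTorus.mFourier_single, Complex.add_conj]

lemma continuous_peakFunction : Continuous (peakFunction (d := d)) := by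
  unfold peakFunction
  fun_prop

lemma abs_re_fourier_le_one (t : UnitAddCircle) : |(fourier 1 t).re| ≤ 1 :=
  (Complex.abs_re_le_norm _).trans (by rw [fourier_one, Circle.norm_coe])

lemma re_fourier_lt_one {t : UnitAddCircle} (ht : t ≠ 0) : (fourier 1 t).re < 1 := by
  refine lt_of_le_of_ne (le_of_abs_le (abs_re_fourier_le_one t)) fun hre => ht ?_
  rw [fourier_one] at hre
  have him : (AddCircle.toCircle t : ℂ).im = 0 :=
    Complex.abs_re_eq_norm.1 (by rw [hre, abs_one, Circle.norm_coe])
  refine AddCircle.injective_toCircle one_ne_zero (Circle.ext ?_)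
  rw [AddCircle.toCircle_zero, Circle.coe_one]
  exact Complex.ext hre him

lemma peakFunction_pos (x : Torus d) : 0 < peakFunction x :=
  add_pos_of_pos_of_nonneg one_pos (Finset.sum_nonneg fun j _ => by
    linarith [neg_le_of_abs_le (abs_re_fourier_le_one (x j))])

lemma peakFunction_lt {x : Torus d} (hx : x ≠ 0) : peakFunction x < peakFunction (0 : Torus d) := by
  obtain ⟨j, hj⟩ := Function.ne_iff.1 hx
  simp only [peakFunction, Pi.zero_apply, fourier_eval_zero, Complex.one_re]
  refine add_lt_add_right (Finset.sum_lt_sum (fun i _ => ?_) ⟨j, Finset.mem_univ j, ?_⟩) 1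
  · linarith [le_of_abs_le (abs_re_fourier_le_one (x i))]
  · linarith [re_fourier_lt_one hj]

lemma exists_isTrigDensity_tendsto (d : ℕ) : ∃ ρ : ℕ → Torus d → ℝ, (∀ n, IsTrigDensity (ρ n)) ∧
    ∀ g : Torus d → ℝ, Continuous g →
      Tendsto (fun n => ∫ x, g x * ρ n x) atTop (𝓝 (g 0)) := by
  have hpos (n : ℕ) : 0 < ∫ x : Torus d, peakFunction x ^ n :=
    (continuous_peakFunction.pow n).integral_pos_of_hasCompactSupport_nonneg_nonzero (x := 0)
      (HasCompactSupport.of_compactSpace _) (fun x => (pow_pos (peakFunction_pos x) n).le)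
      (pow_pos (peakFunction_pos 0) n).ne'
  refine ⟨fun n x => (∫ x : Torus d, peakFunction x ^ n)⁻¹ * peakFunction x ^ n,
    fun n => ⟨fun x => ?_, ?_, ?_⟩, fun g hg => ?_⟩
  · exact mul_nonneg (inv_nonneg.2 (hpos n).le) (pow_pos (peakFunction_pos x) n).le
  · rw [integral_const_mul, inv_mul_cancel₀ (hpos n).ne']
  · obtain ⟨f, hf, hf_eq⟩ := exists_mem_mFourierSubalgebra_eq_peakFunction (d := d)
    refine ⟨((∫ x : Torus d, peakFunction x ^ n)⁻¹ : ℂ) • f ^ n,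
      Subalgebra.smul_mem _ (pow_mem hf n) _, fun x => ?_⟩
    rw [ContinuousMap.smul_apply, ContinuousMap.pow_apply, hf_eq, smul_eq_mul]
    norm_cast
  · have hlim := tendsto_setIntegral_pow_smul_of_unique_maximum_of_isCompact_of_continuousOn
      (μ := (volume : Measure (Torus d))) isCompact_univ continuous_peakFunction.continuousOn
      (fun y _ hy => peakFunction_lt hy) (fun x _ => (peakFunction_pos x).le) (peakFunction_pos 0)
      (by simp) hg.continuousOn
    simp only [Measure.restrict_univ, smul_eq_mul] at hlim
    refine hlim.congr fun n => ?_
    rw [← integral_const_mul]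
    exact integral_congr_ae (Eventually.of_forall fun x => by simp only; ring)

end TrigDensity

section Smoothing

variable {d N : ℕ} {ρ : Torus d → ℝ} {U : ProbTorus d → ℝ} {U₁ : ProbTorus d → Torus d → ℝ}

variable (N) in
/-- The law of `N` independent points with density `ρ`. -/
noncomputable def smoothingLaw (ρ : Torus d → ℝ) : Measure (Fin N → Torus d) :=
  volume.withDensity fun z => ENNReal.ofReal (∏ i, ρ (z i))

variable (N) in
/-- The function `x ↦ Φ(μ_x)`, where `μ_x` is the empirical measure of `x ∈ (𝕋^d)^N`, convolved with
the density `ρ` in each of the `N` variables. -/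
noncomputable def smoothedKernel [NeZero N] (ρ : Torus d → ℝ) (Φ : ProbTorus d → ℝ)
    (x : Fin N → Torus d) : ℝ :=
  ∫ z, Φ (empiricalMeasure (x + z)) ∂smoothingLaw N ρ

variable (N) in
/-- The mean of `Φ` at the empirical measure of `N` independent points, each of which is the sum of
a point of law `m` and an independent perturbation of density `ρ`. -/
noncomputable def smoothedFunctional [NeZero N] (ρ : Torus d → ℝ) (Φ : ProbTorus d → ℝ)
    (m : ProbTorus d) : ℝ :=
  ∫ x, smoothedKernel N ρ Φ x ∂Measure.pi fun _ : Fin N => (m : Measure (Torus d))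

namespace IsTrigDensity

lemma continuous_prod (hρ : IsTrigDensity ρ) :
    Continuous fun z : Fin N → Torus d => ∏ i, ρ (z i) :=
  continuous_finsetProd _ fun i _ => hρ.continuous.comp (continuous_apply i)

lemma integral_smoothingLaw (hρ : IsTrigDensity ρ) (f : (Fin N → Torus d) → ℝ) :
    ∫ z, f z ∂smoothingLaw N ρ = ∫ z, (∏ i, ρ (z i)) * f z := by
  rw [smoothingLaw, integral_withDensity_eq_integral_toReal_smul
    hρ.continuous_prod.measurable.ennreal_ofReal (by simp)]
  simp only [ENNReal.toReal_ofReal (Finset.prod_nonneg fun _ _ => hρ.nonneg _), smul_eq_mul]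

lemma isProbabilityMeasure_smoothingLaw (hρ : IsTrigDensity ρ) :
    IsProbabilityMeasure (smoothingLaw N ρ) := by
  constructor
  rw [smoothingLaw, withDensity_apply _ MeasurableSet.univ, Measure.restrict_univ,
    ← ofReal_integral_eq_lintegral_ofReal (integrable_of_continuous hρ.continuous_prod)
      (Eventually.of_forall fun _ => Finset.prod_nonneg fun _ _ => hρ.nonneg _),
    integral_fintype_prod_volume_eq_prod fun _ => ρ]
  simp only [hρ.integral_eq_one, Finset.prod_const_one, ENNReal.ofReal_one]

lemma integral_comp_apply_smoothingLaw (hρ : IsTrigDensity ρ) (f : Torus d → ℝ) (i : Fin N) :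
    ∫ z, f (z i) ∂smoothingLaw N ρ = ∫ x, f x * ρ x := by
  let g : Fin N → Torus d → ℝ := Function.update (fun _ => ρ) i fun x => f x * ρ x
  have hprod (z : Fin N → Torus d) : (∏ j, ρ (z j)) * f (z i) = ∏ j, g j (z j) := by
    rw [prod_apply_update fun j (h : Torus d → ℝ) => h (z j),
      ← Finset.mul_prod_erase _ _ (Finset.mem_univ i)]
    ring
  rw [hρ.integral_smoothingLaw]
  simp_rw [hprod]
  rw [integral_fintype_prod_volume_eq_prod,
    prod_apply_update fun _ (h : Torus d → ℝ) => ∫ x, h x]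
  simp only [hρ.integral_eq_one, Finset.prod_const_one, mul_one]

/-- Moving the translation onto the density makes the dependence on `x` trigonometric. -/
lemma integral_add_smoothingLaw_mem_tensorSpan (hρ : IsTrigDensity ρ) {F : (Fin N → Torus d) → ℝ}
    (hF : Continuous F) : (fun _ x => ∫ z, F (x + z) ∂smoothingLaw N ρ) ∈ tensorSpan d 0 N := by
  obtain ⟨f, hf, hf_eq⟩ := hρ.exists_mem
  obtain ⟨ι, _, c, a, ha, hsub⟩ := exists_re_sub_eq_sum hf
  have hexpand (x z : Fin N → Torus d) : (∏ i, ρ ((z - x) i)) * F (x + (z - x)) =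
      ∑ p : Fin N → ι, (F z * ∏ i, c (p i) (z i)) * ∏ i, a (p i) (x i) := by
    simp only [Pi.sub_apply, ← hf_eq, hsub, Finset.prod_univ_sum, Finset.prod_mul_distrib,
      Finset.sum_mul, add_sub_cancel, Fintype.piFinset_univ]
    exact Finset.sum_congr rfl fun p _ => by ring
  have hsum : (fun (_ : Fin 0 → Torus d) x => ∫ z, F (x + z) ∂smoothingLaw N ρ) =
      ∑ p : Fin N → ι, (∫ z, F z * ∏ i, c (p i) (z i)) •
        tensorKernel (Fin.elim0 : Fin 0 → C(Torus d, ℝ)) (fun i => a (p i)) := by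
    have : Measure.IsAddHaarMeasure (volume : Measure (Fin N → Torus d)) :=
      Measure.pi.isAddHaarMeasure fun _ => volume
    funext y x
    rw [hρ.integral_smoothingLaw, ← integral_sub_right_eq_self _ x]
    simp_rw [hexpand]
    rw [integral_finsetSum _ fun p _ => integrable_of_continuous (by fun_prop)]
    simp only [integral_mul_const, Finset.sum_apply, Pi.smul_apply, smul_eq_mul, tensorKernel,
      Finset.univ_eq_empty, Finset.prod_empty, one_mul]
  rw [hsum]
  exact Submodule.sum_mem _ fun p _ => Submodule.smul_mem _ _
    (tensorKernel_mem_tensorSpan (fun i => i.elim0) fun i => ha (p i))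

lemma smoothedKernel_mem_tensorSpan [NeZero N] (hρ : IsTrigDensity ρ) (hU : Continuous U) :
    (fun _ => smoothedKernel N ρ U) ∈ tensorSpan d 0 N :=
  hρ.integral_add_smoothingLaw_mem_tensorSpan (hU.comp continuous_empiricalMeasure)

lemma smoothFunctional_smoothedFunctional [NeZero N] (hρ : IsTrigDensity ρ) (hU : Continuous U) :
    SmoothFunctional (smoothedFunctional N ρ U) :=
  have hmem := hρ.smoothedKernel_mem_tensorSpan hU
  smoothFunctional_of_hasCrossedDerivs (isFlatDeriv_polyFunctional hmem) fun ℓ =>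
    hasCrossedDerivs_polyFunctional (flatKernelSeq_mem_tensorSpan hmem ℓ)

end IsTrigDensity

section Convergence

lemma IsLinearDeriv.abs_empiricalMeasure_add_sub_le [NeZero N] (h : IsLinearDeriv U U₁)
    {ω : Torus d → ℝ} (hω : ∀ n x t, |U₁ n (x + t) - U₁ n x| ≤ ω t) (x z : Fin N → Torus d) :
    |U (empiricalMeasure (x + z)) - U (empiricalMeasure x)| ≤ (∑ i, ω (z i)) / N := by
  refine h.abs_sub_le fun n => ?_
  have hcont := h.continuous_deriv_apply n
  rw [integral_empiricalMeasure _ hcont, integral_empiricalMeasure _ hcont, ← sub_div,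
    ← Finset.sum_sub_distrib, abs_div, Nat.abs_cast]
  gcongr
  exact (Finset.abs_sum_le_sum_abs _ _).trans (Finset.sum_le_sum fun i _ => hω n (x i) (z i))

lemma IsLinearDeriv.abs_smoothedKernel_sub_le [NeZero N] (h : IsLinearDeriv U U₁)
    (hρ : IsTrigDensity ρ) {ω : C(Torus d, ℝ)} (hω : ∀ n x t, |U₁ n (x + t) - U₁ n x| ≤ ω t)
    (x : Fin N → Torus d) :
    |smoothedKernel N ρ U x - U (empiricalMeasure x)| ≤ ∫ t, ω t * ρ t := by
  have := hρ.isProbabilityMeasure_smoothingLaw (N := N)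
  have hcont : Continuous fun z => U (empiricalMeasure (x + z)) :=
    h.continuous.comp (continuous_empiricalMeasure.comp (by fun_prop))
  refine (abs_integral_sub_const_le (integrable_of_continuous hcont)
    (integrable_of_continuous (by fun_prop))
    fun z => h.abs_empiricalMeasure_add_sub_le hω x z).trans_eq ?_
  rw [integral_div, integral_finsetSum _ fun i _ => integrable_of_continuous (by fun_prop)]
  simp only [hρ.integral_comp_apply_smoothingLaw, Finset.sum_const, Finset.card_univ,
    Fintype.card_fin, nsmul_eq_mul, mul_div_cancel_left₀ _ (NeZero.ne (N : ℝ))]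

lemma IsLinearDeriv.tendstoUniformly_smoothedFunctional (h : IsLinearDeriv U U₁)
    {ρ : ℕ → Torus d → ℝ} (hρ : ∀ n, IsTrigDensity (ρ n))
    (hlim : ∀ g : Torus d → ℝ, Continuous g →
      Tendsto (fun n => ∫ x, g x * ρ n x) atTop (𝓝 (g 0))) :
    TendstoUniformly (fun n => smoothedFunctional (n + 1) (ρ n) U) U atTop := by
  obtain ⟨ω, hω_zero, hω⟩ := exists_translation_modulus h.continuous_deriv
  have hkernel (n : ℕ) (m : ProbTorus d) : |smoothedFunctional (n + 1) (ρ n) U m -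
      ∫ x, U (empiricalMeasure x) ∂(Measure.pi fun _ : Fin (n + 1) => (m : Measure (Torus d)))| ≤
        ∫ t, ω t * ρ n t :=
    abs_integral_sub_integral_le
      (integrable_of_continuous (continuous_of_mem_tensorSpan
        ((hρ n).smoothedKernel_mem_tensorSpan h.continuous) Fin.elim0))
      (integrable_of_continuous (h.continuous.comp continuous_empiricalMeasure))
      fun x => h.abs_smoothedKernel_sub_le (hρ n) hω x
  rw [Metric.tendstoUniformly_iff]
  intro ε hε
  filter_upwards [Metric.tendstoUniformly_iff.1 h.tendstoUniformly_integral_empiricalMeasure _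
    (half_pos hε), (hlim ω ω.continuous).eventually_lt_const (hω_zero ▸ half_pos hε)]
    with n hempirical hdensity m
  rw [dist_comm]
  have hmean := hempirical m
  rw [dist_comm] at hmean
  exact (dist_triangle _ _ _).trans_lt <|
    (add_lt_add ((hkernel n m).trans_lt hdensity) hmean).trans_eq (add_halves ε)

end Convergence

section Bounds

lemma hasDiffBound_smoothedKernel [NeZero N] {U₂ : ProbTorus d → Torus d → Torus d → ℝ}
    {w : Torus d → Torus d → ℝ} (hρ : IsTrigDensity ρ) (h₁ : IsLinearDeriv U U₁)
    (h₂ : ∀ a, IsLinearDeriv (fun m => U₁ m a) fun m => U₂ m a)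
    (hw : ∀ a a' c, w (a + c) (a' + c) = w a a') (hw₁ : ∀ n a a', |U₁ n a - U₁ n a'| ≤ w a a')
    (hw₂ : ∀ n a a' b, |U₂ n a b - U₂ n a' b| ≤ w a a') :
    HasDiffBound (smoothedKernel N ρ U) w :=
  have := hρ.isProbabilityMeasure_smoothingLaw (N := N)
  (hasDiffBound_empiricalMeasure h₁ h₂ hw₁ hw₂).integral_add
    (h₁.continuous.comp continuous_empiricalMeasure) hw _

lemma dist_vecCons_left_le (a a' b : Torus d) : dist ![a, b] ![a', b] ≤ dist a a' :=
  (dist_pi_le_iff dist_nonneg).2 (Fin.forall_fin_two.2 ⟨le_rfl, by simp⟩)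

lemma IsFlatDeriv.intPhiBound_smoothedFunctional [NeZero N] {α C : ℝ}
    {V : (ℓ : ℕ) → ProbTorus d → (Fin ℓ → Torus d) → ℝ} (hV : IsFlatDeriv 2 U V) (hα : α < 1)
    (hbound : ∀ ℓ ≤ 2, (∀ m y, |V ℓ m y| ≤ C) ∧
      (0 < α → ∀ m y z, |V ℓ m y - V ℓ m z| ≤ C * dist y z ^ α)) (hρ : IsTrigDensity ρ) :
    IntPhiBound α 2 (10 * C) (smoothedFunctional N ρ U) := by
  have h₁ := hV.isLinearDeriv_zero two_pos
  have h₂ := hV.isLinearDeriv_one one_lt_two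
  have hle (ℓ : ℕ) (hℓ : ℓ ≤ 2) (m : ProbTorus d) (y z : Fin ℓ → Torus d) :
      |V ℓ m y - V ℓ m z| ≤ 2 * C := (abs_sub _ _).trans <| by
    linarith [(hbound ℓ hℓ).1 m y, (hbound ℓ hℓ).1 m z]
  have hU (m : ProbTorus d) : |U m| ≤ C := hV.zero m ![] ▸ (hbound 0 zero_le_two).1 m ![]
  have hC : 0 ≤ C := (abs_nonneg _).trans (hU (diracProba 0))
  have := hρ.isProbabilityMeasure_smoothingLaw (N := N)
  refine intPhiBound_of_hasDiffBound (hρ.smoothedKernel_mem_tensorSpan h₁.continuous) hα hC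
    (fun x => abs_integral_le_of_abs_le fun z => hU _) ?_ fun hpos => ?_
  · exact hasDiffBound_smoothedKernel hρ h₁ h₂ (fun _ _ _ => rfl)
      (fun n a a' => hle 1 one_le_two n _ _) fun n a a' b => hle 2 le_rfl n _ _
  · refine hasDiffBound_smoothedKernel hρ h₁ h₂ (fun a a' c => by rw [dist_add_right])
      (fun n a a' => ((hbound 1 one_le_two).2 hpos n _ _).trans ?_)
      fun n a a' b => ((hbound 2 le_rfl).2 hpos n _ _).trans ?_
    · gcongr
      exact (dist_pi_le_iff dist_nonneg).2 (Fin.forall_fin_one.2 le_rfl)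
    · gcongr
      exact dist_vecCons_left_le a a' b

end Bounds

end Smoothing

theorem theoremA1 (d : ℕ) (α : ℝ) (hα0 : 0 ≤ α) (hα1 : α < 1) (Φ : ProbTorus d → ℝ)
    (hΦ : IntPhi α 2 Φ) :
    ∃ Φn : ℕ → ProbTorus d → ℝ,
      (∀ n, SmoothFunctional (Φn n) ∧ IntPhi 4 3 (Φn n)) ∧
      TendstoUniformly Φn Φ atTop ∧
      ∃ C : ℝ, ∀ n, IntPhiBound α 2 C (Φn n) := by
  obtain ⟨C, hC⟩ := hΦ
  obtain ⟨V, hV, hbound⟩ := (intPhiBound_iff_of_lt_one hα1).1 hC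
  obtain ⟨ρ, hρ, hlim⟩ := exists_isTrigDensity_tendsto d
  have hderiv := hV.isLinearDeriv_zero two_pos
  have hsmooth (n : ℕ) : SmoothFunctional (smoothedFunctional (n + 1) (ρ n) Φ) :=
    (hρ n).smoothFunctional_smoothedFunctional hderiv.continuous
  exact ⟨fun n => smoothedFunctional (n + 1) (ρ n) Φ,
    fun n => ⟨hsmooth n, by simpa using hsmooth n 4 3⟩,
    hderiv.tendstoUniformly_smoothedFunctional hρ hlim,
    10 * C, fun n => hV.intPhiBound_smoothedFunctional hα1 hbound (hρ n)⟩
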